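/- Let $\mathbb H$ be the real quaternions with standard basis $e_0=1,e_1,e_2,e_3$. Let $\mathcal O_{\mathbb H}$ be the right $\mathbb H$-module of germs at $0$ of functions $f$ that are left-hyperholomorphic in a neighbourhood of $0$ (real differentiable with $\sum_{i=0}^3 e_i\,\partial f/\partial x_i=0$). Put $\zeta_k(x)=x_k-x_0e_k$ for $k=1,2,3$. For $\nu\in\mathbb Z_+^3$ let $\zeta^\nu$ be the Fueter polynomial, i.e. the symmetrized product $\frac1{|\nu|!}\sum_{\sigma}a_{\sigma(1)}\cdots a_{\sigma(|\nu|)}$ of $\nu_1$ copies of $\zeta_1$, $\nu_2$ copies of $\zeta_2$ and $\nu_3$ copies of $\zeta_3$, and let $f_\nu=\frac1{\nu!}\left(\frac{\partial^{|\nu|}f}{\partial x_1^{\nu_1}\partial x_2^{\nu_2}\partial x_3^{\nu_3}}\right)(0)$. The Cauchy–Kovalevskaya (C-K) product is $f\odot g=\sum_\eta\zeta^\eta\sum_{0\le\nu\le\eta}f_\nu g_{\eta-\nu}$, extended to matrix-valued functions in the usual way, and $F^{-\odot}$ denotes the inverse for $\odot$. For a subspace (right $\mathbb H$-submodule) $\mathcal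 W\subset\mathcal O_{\mathbb H}^m$ and $f\in\mathcal O_{\mathbb H}^m$, the Gleason problem for $f$ is solvable in $\mathcal W$ if there are $g_1,g_2,g_3\in\mathcal W$ with $f-f(0)=\sum_{k=1}^3\zeta_k\odot g_k$. The subspace $\mathcal W$ is resolvent-invariant if the Gleason problem is solvable in $\mathcal W$ for every $f\in\mathcal W$. Let $R\in\mathcal O_{\mathbb H}^{m\times n}$. Then the following two statements are equivalent: (i) $R$ has a realization, i.e. there are an integer $p\ge 0$ and constant matrices $A_k\in\mathbb H^{p\times p}$, $B_k\in\mathbb H^{p\times n}$ $(k=1,2,3)$, $C\in\mathbb H^{m\times p}$, $D\in\mathbb H^{m\times n}$ such that $$R=D+C\odot(I_p-\zeta_1A_1-\zeta_2A_2-\zeta_3A_3)^{-\odot}\odot(\zeta_1B_1+\zeta_2B_2+\zeta_3B_3);$$ (ii) there is a finite-dimensional resolvent-invariant subspace $\mathcal W\subset\mathcal O_{\mathbb H}^m$ such that for every constant vector $v\in\mathbb H^n$ the Gleason problem for $Rv$ is solvable in $\mathcal W$. Moreover, they are also equivalent to (iii) all entries of $R$ belong to the smallest subring $\mathcal Q_{\mathbb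 H}$ of $(\mathcal O_{\mathbb H},+,\odot)$ that contains the hyperholomorphic polynomials and is closed under C-K inversion (if $r\in\mathcal Q_{\mathbb H}$ and $r(0)\ne0$, then $r$ has a C-K inverse $r^{-\odot}\in\mathcal Q_{\mathbb H}$). -/

import Mathlib

open scoped Quaternion Topology

namespace Hyperholo

noncomputable section

/-- The standard basis `e₀ = 1, e₁, e₂, e₃` of the quaternions. -/
def e : Fin 4 → ℍ[ℝ] :=
  ![⟨1, 0, 0, 0⟩, ⟨0, 1, 0, 0⟩, ⟨0, 0, 1, 0⟩, ⟨0, 0, 0, 1⟩]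

/-- The real coordinates `x₀, x₁, x₂, x₃` of a quaternion. -/
def coord (x : ℍ[ℝ]) : Fin 4 → ℝ := ![x.re, x.imI, x.imJ, x.imK]

/-- The partial derivative `∂F/∂xᵢ`. -/
def partialDeriv (i : Fin 4) (F : ℍ[ℝ] → ℍ[ℝ]) (x : ℍ[ℝ]) : ℍ[ℝ] := fderiv ℝ F x (e i)

/-- `F` is left-hyperholomorphic in a neighbourhood of the origin: it is real differentiable and
satisfies the Cauchy-Fueter equation `∑ᵢ eᵢ ∂F/∂xᵢ = 0` there. -/
def HyperholoNearZero (F : ℍ[ℝ] → ℍ[ℝ]) : Prop :=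
  ∀ᶠ x in 𝓝 (0 : ℍ[ℝ]), DifferentiableAt ℝ F x ∧ ∑ i, e i * partialDeriv i F x = 0

/-- Germs at the origin of quaternion-valued functions, a right `ℍ`-module (that is, a module
over the opposite ring, `MulOpposite.op a • f = f a`). -/
abbrev QGerm : Type := Filter.Germ (𝓝 (0 : ℍ[ℝ])) ℍ[ℝ]

/-- The right `ℍ`-module of germs at the origin of functions that are left-hyperholomorphic in a
neighbourhood of the origin. -/
def hyperholoGerms : Submodule ℍ[ℝ]ᵐᵒᵖ QGerm where
  carrier := {f | ∃ F : ℍ[ℝ] → ℍ[ℝ], f = (F : QGerm) ∧ HyperholoNearZero F}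
  zero_mem' := by
    refine ⟨fun _ => 0, rfl, Filter.Eventually.of_forall fun x => ⟨by fun_prop, ?_⟩⟩
    simp [partialDeriv]
  add_mem' := by
    rintro _ _ ⟨F, rfl, hF⟩ ⟨G, rfl, hG⟩
    refine ⟨F + G, rfl, ?_⟩
    filter_upwards [hF, hG] with x ⟨hF1, hF2⟩ ⟨hG1, hG2⟩
    refine ⟨hF1.add hG1, ?_⟩
    have h : ∀ i, partialDeriv i (F + G) x = partialDeriv i F x + partialDeriv i G x := by
      intro i
      simp [partialDeriv, fderiv_add hF1 hG1]
    simp only [h, mul_add, Finset.sum_add_distrib, hF2, hG2, add_zero]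
  smul_mem' := by
    rintro a _ ⟨F, rfl, hF⟩
    refine ⟨fun x => F x * a.unop, rfl, ?_⟩
    filter_upwards [hF] with x ⟨hF1, hF2⟩
    refine ⟨hF1.mul_const _, ?_⟩
    have h : ∀ i, partialDeriv i (fun x => F x * a.unop) x = partialDeriv i F x * a.unop := by
      intro i
      simp [partialDeriv, fderiv_mul_const' hF1]
    simp only [h, ← mul_assoc, ← Finset.sum_mul, hF2, zero_mul]

/-- The space of germs at the origin of left-hyperholomorphic functions. -/
abbrev OH : Type := hyperholoGerms

/-- The value at the origin. -/
def val (f : OH) : ℍ[ℝ] := Filter.Germ.value (f : QGerm)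

/-- The constant function `a`. -/
def const (a : ℍ[ℝ]) : OH :=
  ⟨((fun _ => a : ℍ[ℝ] → ℍ[ℝ]) : QGerm), fun _ => a, rfl,
    Filter.Eventually.of_forall fun x => ⟨by fun_prop, by simp [partialDeriv]⟩⟩

/-- The function `ζₖ(x) = xₖ - x₀ eₖ`; the index `k : Fin 3` stands for `k + 1 ∈ {1, 2, 3}`. -/
def zetaFun (k : Fin 3) (x : ℍ[ℝ]) : ℍ[ℝ] :=
  (coord x k.succ : ℍ[ℝ]) - coord x 0 • e k.succ

/-- `ζₖ` as a real linear map. -/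
def zetaLin (k : Fin 3) : ℍ[ℝ] →ₗ[ℝ] ℍ[ℝ] where
  toFun := zetaFun k
  map_add' x y := by
    fin_cases k <;> ext <;>
    simp only [Quaternion.re_add, Quaternion.imI_add, Quaternion.imJ_add, Quaternion.imK_add,
      zetaFun, Quaternion.re_sub, Quaternion.imI_sub, Quaternion.imJ_sub, Quaternion.imK_sub,
      Quaternion.re_smul, Quaternion.imI_smul, Quaternion.imJ_smul, Quaternion.imK_smul] <;>
    simp [coord, e] <;> ring
  map_smul' a x := by
    fin_cases k <;> ext <;>
    simp only [zetaFun, Quaternion.re_sub, Quaternion.imI_sub, Quaternion.imJ_sub, Quaternion.imK_sub,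
      Quaternion.re_smul, Quaternion.imI_smul, Quaternion.imJ_smul, Quaternion.imK_smul] <;>
    simp [coord, e]

theorem hasFDerivAt_zetaFun (k : Fin 3) (x : ℍ[ℝ]) :
    HasFDerivAt (zetaFun k) (LinearMap.toContinuousLinearMap (zetaLin k)) x :=
  (LinearMap.toContinuousLinearMap (zetaLin k)).hasFDerivAt

theorem hyperholoNearZero_zetaFun (k : Fin 3) : HyperholoNearZero (zetaFun k) := by
  refine Filter.Eventually.of_forall fun x => ⟨(hasFDerivAt_zetaFun k x).differentiableAt, ?_⟩
  have h : ∀ i, partialDeriv i (zetaFun k) x = zetaFun k (e i) := by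
    intro i
    rw [partialDeriv, (hasFDerivAt_zetaFun k x).fderiv]
    rfl
  simp only [h, Fin.sum_univ_four]
  fin_cases k <;> ext <;>
    simp only [Quaternion.re_add, Quaternion.imI_add, Quaternion.imJ_add, Quaternion.imK_add,
      Quaternion.re_mul, Quaternion.imI_mul, Quaternion.imJ_mul, Quaternion.imK_mul, zetaFun,
      Quaternion.re_sub, Quaternion.imI_sub, Quaternion.imJ_sub, Quaternion.imK_sub,
      Quaternion.re_smul, Quaternion.imI_smul, Quaternion.imJ_smul, Quaternion.imK_smul] <;>
    simp [coord, e]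

/-- The hyperholomorphic variable `ζₖ`. -/
def zeta (k : Fin 3) : OH := ⟨(zetaFun k : QGerm), zetaFun k, rfl, hyperholoNearZero_zetaFun k⟩

/-- The symmetrized product `a₁ × ⋯ × aₙ = (1/n!) ∑_σ a_{σ(1)} ⋯ a_{σ(n)}`. -/
def symProd (l : List ℍ[ℝ]) : ℍ[ℝ] :=
  ((l.length.factorial : ℕ) : ℝ)⁻¹ •
    ∑ σ : Equiv.Perm (Fin l.length), (List.ofFn fun i => l.get (σ i)).prod

/-- The Fueter polynomial `ζ^ν`: the symmetrized product of `ν₁` copies of `ζ₁`, `ν₂` copies of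
`ζ₂` and `ν₃` copies of `ζ₃`. -/
def fueter (ν : Fin 3 →₀ ℕ) (x : ℍ[ℝ]) : ℍ[ℝ] :=
  symProd (List.replicate (ν 0) (zetaFun 0 x) ++ List.replicate (ν 1) (zetaFun 1 x) ++
    List.replicate (ν 2) (zetaFun 2 x))

/-- The partial derivative `∂f/∂xᵢ` of a germ. -/
def germDeriv (i : Fin 4) : QGerm → QGerm :=
  Filter.Germ.map' (partialDeriv i) fun _ _ h => by
    filter_upwards [h.fderiv (𝕜 := ℝ)] with x hx
    simp only [partialDeriv, hx]

/-- The coefficient `f_ν = (1/ν!) (∂^ν f)(0)`, where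
`∂^ν = ∂^{|ν|} / ∂x₁^{ν₁} ∂x₂^{ν₂} ∂x₃^{ν₃}`. -/
def coeff (ν : Fin 3 →₀ ℕ) (f : OH) : ℍ[ℝ] :=
  ((∏ k, (ν k).factorial : ℕ) : ℝ)⁻¹ •
    Filter.Germ.value
      ((germDeriv 1)^[ν 0] ((germDeriv 2)^[ν 1] ((germDeriv 3)^[ν 2] (f : QGerm))))

/-- `h` is the Cauchy-Kovalevskaya product `f ⊙ g`: near the origin,
`h(x) = ∑_η ζ^η(x) ∑_{ν + μ = η} f_ν g_μ`, the series being convergent. -/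
def IsCKProd (f g h : OH) : Prop :=
  ∃ H : ℍ[ℝ] → ℍ[ℝ], (h : QGerm) = (H : QGerm) ∧
    ∀ᶠ x in 𝓝 (0 : ℍ[ℝ]),
      HasSum (fun η : Fin 3 →₀ ℕ =>
        fueter η x * ∑ p ∈ Finset.HasAntidiagonal.antidiagonal η, coeff p.1 f * coeff p.2 g) (H x)

/-- `g` is the Cauchy-Kovalevskaya inverse of `f`. -/
def IsCKInv (f g : OH) : Prop := IsCKProd f g (const 1) ∧ IsCKProd g f (const 1)

/-- `H` is the Cauchy-Kovalevskaya product `F ⊙ G` of matrix-valued functions, with entries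
`H_{α γ} = ∑_β F_{α β} ⊙ G_{β γ}`. -/
def IsMatCKProd {a b c : ℕ} (F : Matrix (Fin a) (Fin b) OH) (G : Matrix (Fin b) (Fin c) OH)
    (H : Matrix (Fin a) (Fin c) OH) : Prop :=
  ∃ T : Fin a → Fin b → Fin c → OH,
    (∀ i j k, IsCKProd (F i j) (G j k) (T i j k)) ∧ ∀ i k, H i k = ∑ j, T i j k

/-- A constant matrix as a matrix-valued function. -/
def constMat {a b : ℕ} (M : Matrix (Fin a) (Fin b) ℍ[ℝ]) : Matrix (Fin a) (Fin b) OH :=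
  M.map const

/-- `G` is the Cauchy-Kovalevskaya inverse of the square matrix-valued function `F`. -/
def IsMatCKInv {a : ℕ} (F G : Matrix (Fin a) (Fin a) OH) : Prop :=
  IsMatCKProd F G (constMat 1) ∧ IsMatCKProd G F (constMat 1)

/-- The matrix-valued function `ζ₁ M₁ + ζ₂ M₂ + ζ₃ M₃`, for constant matrices `Mₖ`. -/
def zetaMat {a b : ℕ} (M : Fin 3 → Matrix (Fin a) (Fin b) ℍ[ℝ]) : Matrix (Fin a) (Fin b) OH :=
  fun i j => ∑ k, MulOpposite.op (M k i j) • zeta k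

/-- `R = D + C ⊙ (I - ζ₁A₁ - ζ₂A₂ - ζ₃A₃)^{-⊙} ⊙ (ζ₁B₁ + ζ₂B₂ + ζ₃B₃)` for constant matrices
`Aₖ, Bₖ, C, D`. Here `X = (I - ζA)^{-⊙}`, `Y = C ⊙ X` and `Z = Y ⊙ ζB`. -/
def HasRealization {m n : ℕ} (R : Matrix (Fin m) (Fin n) OH) : Prop :=
  ∃ (p : ℕ) (A : Fin 3 → Matrix (Fin p) (Fin p) ℍ[ℝ]) (B : Fin 3 → Matrix (Fin p) (Fin n) ℍ[ℝ])
    (C : Matrix (Fin m) (Fin p) ℍ[ℝ]) (D : Matrix (Fin m) (Fin n) ℍ[ℝ])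
    (X : Matrix (Fin p) (Fin p) OH) (Y : Matrix (Fin m) (Fin p) OH)
    (Z : Matrix (Fin m) (Fin n) OH),
    IsMatCKInv (constMat 1 - zetaMat A) X ∧
    IsMatCKProd (constMat C) X Y ∧
    IsMatCKProd Y (zetaMat B) Z ∧
    R = constMat D + Z

/-- The Gleason problem for `f` is solvable in `W`: there are `g₁, g₂, g₃ ∈ W` such that
`f - f(0) = ∑ₖ ζₖ ⊙ gₖ` (here `hₖ = ζₖ ⊙ gₖ`, entrywise). -/
def GleasonSolvableIn {m : ℕ} (W : Submodule ℍ[ℝ]ᵐᵒᵖ (Fin m → OH)) (f : Fin m → OH) : Prop :=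
  ∃ g h : Fin 3 → Fin m → OH,
    (∀ k, g k ∈ W) ∧ (∀ k i, IsCKProd (zeta k) (g k i) (h k i)) ∧
    (f - fun i => const (val (f i))) = ∑ k, h k

/-- `W` is resolvent-invariant. -/
def ResolventInvariant {m : ℕ} (W : Submodule ℍ[ℝ]ᵐᵒᵖ (Fin m → OH)) : Prop :=
  ∀ f ∈ W, GleasonSolvableIn W f

/-- The function `R v`, for a constant column `v`. -/
def applyVec {m n : ℕ} (R : Matrix (Fin m) (Fin n) OH) (v : Fin n → ℍ[ℝ]) : Fin m → OH :=
  fun i => ∑ j, MulOpposite.op (v j) • R i j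

/-- There is a finite-dimensional resolvent-invariant space in which the Gleason problem for `R v`
is solvable, for every constant column `v`. -/
def HasResolventInvariantSpace {m n : ℕ} (R : Matrix (Fin m) (Fin n) OH) : Prop :=
  ∃ W : Submodule ℍ[ℝ]ᵐᵒᵖ (Fin m → OH), FiniteDimensional ℍ[ℝ]ᵐᵒᵖ W ∧ ResolventInvariant W ∧
    ∀ v : Fin n → ℍ[ℝ], GleasonSolvableIn W (applyVec R v)

/-- `f` is a hyperholomorphic polynomial: a left-hyperholomorphic function whose four components
are real polynomials in `x₀, x₁, x₂, x₃`. -/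
def IsPolynomial (f : OH) : Prop :=
  ∃ P : Fin 4 → MvPolynomial (Fin 4) ℝ,
    (f : QGerm) = ((fun x => ∑ i, (P i).eval (coord x) • e i : ℍ[ℝ] → ℍ[ℝ]) : QGerm)

/-- `S` is a subring, for the Cauchy-Kovalevskaya product, of the ring of germs of
left-hyperholomorphic functions, contains all hyperholomorphic polynomials and is closed under
Cauchy-Kovalevskaya inversion of those elements that do not vanish at the origin. -/
structure IsInversionClosedSubring (S : AddSubgroup OH) : Prop where
  one_mem : const 1 ∈ S
  mul_mem : ∀ f g h : OH, f ∈ S → g ∈ S → IsCKProd f g h → h ∈ S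
  poly_mem : ∀ f : OH, IsPolynomial f → f ∈ S
  inv_mem : ∀ f ∈ S, val f ≠ 0 → ∃ g ∈ S, IsCKInv f g

/-- All the entries of `R` lie in the smallest subring that contains the hyperholomorphic
polynomials and is closed under Cauchy-Kovalevskaya inversion. -/
def IsCKRational {m n : ℕ} (R : Matrix (Fin m) (Fin n) OH) : Prop :=
  ∀ i j, ∀ S : AddSubgroup OH, IsInversionClosedSubring S → R i j ∈ S

end

end Hyperholo

/-!
A germ that is the sum of its Fueter series `∑ ζ^ν f_ν` is determined by its coefficients, and the
Cauchy-Kovalevskaya product multiplies these coefficients like those of power series. So the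
statement is one about the ring of convergent power series in three central variables `X₁, X₂, X₃`
(the images of the `ζₖ`) over the quaternions. Elliptic regularity is not needed: all the
functions that matter are sums of their Fueter series by construction. For a convergent power
series the Fueter series converges to a hyperholomorphic function with the given coefficients
(`hyperholoNearZero_fueterSum`, `coeff_of_eq_fueterSum`), because the Fueter polynomials satisfy
`∂ζ^ν / ∂xₖ = νₖ ζ^{ν - eₖ}`. Conversely `HasFueterSeries.isConv` recovers the convergence of the
power series from the behaviour on the hyperplane `x₀ = 0`, where `ζ^ν = x^ν`. A hyperholomorphic
polynomial is a combination of the `ζ^ν`, by uniqueness in the Cauchy problem for the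
Cauchy-Fueter equation (`IsPolynomial.exists_hasFueterSeries`).

Realizations and resolvent-invariant spaces correspond to each other as in the theory of linear
systems. The columns of `Φ = C (1 - XA)⁻¹` span a resolvent-invariant space since
`Φ = C + Φ XA`. Conversely, solving the Gleason problem for generators of such a space and for the
columns of `R` gives `Φ = C + Φ XA` and `R = D + Φ XB`; the first identity forces
`Φ = C (1 - XA)⁻¹`.

The entries of a realization are rational because `1 - XA` is invertible over every subring `S` of
power series that contains the inverses of its elements with nonzero constant term: in `S` the
series without constant term lie in the Jacobson radical, and the radical passes to matrices
(`InverseClosed.exists_matrix_inv`). Conversely, call a finite-dimensional real space `V` of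
convergent series, stable under left multiplication by constants, a backward space if every
`c ∈ V` is `c(0) + ∑ₖ Xₖ gₖ` with `gₖ ∈ V`. The series lying in some backward space contain the
constants and the variables and are closed under sums, products and inverses
(`inverseClosed_backwardSubring`), hence contain all rational functions. Finitely many of them lie
in a common backward space, and the columns with entries in the right `ℍ`-module it generates form
the resolvent-invariant space that is sought.
-/

open scoped Quaternion Topology

namespace Hyperholo

noncomputable section

/-! ### Symmetrized products and Fueter polynomials -/

/-- The unnormalized symmetrized product `∑_σ a_{σ(0)} ⋯ a_{σ(n-1)}` of a finite family. -/
def permSum {n : ℕ} (a : Fin n → ℍ[ℝ]) : ℍ[ℝ] :=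
  ∑ σ : Equiv.Perm (Fin n), (List.ofFn fun i => a (σ i)).prod

theorem permSum_comp {n : ℕ} (a : Fin n → ℍ[ℝ]) (τ : Equiv.Perm (Fin n)) :
    permSum (a ∘ τ) = permSum a :=
  Equiv.sum_comp (Equiv.mulLeft τ) fun σ : Equiv.Perm (Fin n) =>
    (List.ofFn fun i => a (σ i)).prod

/-- Sorting the words of a symmetrized product by their first letter. -/
theorem permSum_succ {n : ℕ} (a : Fin (n + 1) → ℍ[ℝ]) :
    permSum a = ∑ p, a p * permSum fun i : Fin n => a (Equiv.swap 0 p i.succ) := by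
  rw [permSum, ← Equiv.Perm.decomposeFin.symm.sum_comp, Fintype.sum_prod_type]
  refine Finset.sum_congr rfl fun p _ => ?_
  rw [permSum, Finset.mul_sum]
  refine Finset.sum_congr rfl fun σ _ => ?_
  simp [List.ofFn_succ]

/-- The word `κ` contains the letter `k` exactly `ν k` times. -/
def HasContent {n : ℕ} (κ : Fin n → Fin 3) (ν : Fin 3 →₀ ℕ) : Prop :=
  Finset.univ.val.map κ = Finsupp.toMultiset ν

theorem HasContent.length {n : ℕ} {κ : Fin n → Fin 3} {ν : Fin 3 →₀ ℕ} (h : HasContent κ ν) :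
    n = ν.degree := by
  have := congrArg Multiset.card h
  simpa [Finsupp.card_toMultiset, Finsupp.degree_apply, Finsupp.sum] using this

theorem HasContent.exists_perm {n : ℕ} {κ κ' : Fin n → Fin 3} {ν : Fin 3 →₀ ℕ}
    (h : HasContent κ ν) (h' : HasContent κ' ν) : ∃ σ : Equiv.Perm (Fin n), κ' ∘ σ = κ := by
  have hc : ∀ (f : Fin n → Fin 3) (k : Fin 3), HasContent f ν →
      Fintype.card {i // f i = k} = ν k := by
    intro f k hf
    have := congrArg (Multiset.count k) hf
    rw [Multiset.count_map, Finsupp.count_toMultiset] at this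
    rw [Fintype.card_subtype, ← this, Finset.card_def, Finset.filter_val]
    simp only [eq_comm]
  have e : ∀ k, {i // κ i = k} ≃ {i // κ' i = k} := fun k =>
    Fintype.equivOfCardEq (by rw [hc κ k h, hc κ' k h'])
  exact ⟨Equiv.ofFiberEquiv e, funext fun i => Equiv.ofFiberEquiv_map e i⟩

theorem exists_hasContent (ν : Fin 3 →₀ ℕ) {n : ℕ} (hn : ν.degree = n) :
    ∃ κ : Fin n → Fin 3, HasContent κ ν := by
  have hlen : (Finsupp.toMultiset ν).toList.length = n := by
    rw [Multiset.length_toList, Finsupp.card_toMultiset, ← hn]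
    simp [Finsupp.degree_apply, Finsupp.sum]
  subst hlen
  refine ⟨(Finsupp.toMultiset ν).toList.get, ?_⟩
  rw [HasContent, Fin.univ_val_map, List.ofFn_get, Multiset.coe_toList]

theorem symProd_ofFn {n : ℕ} (a : Fin n → ℍ[ℝ]) :
    symProd (List.ofFn a) = ((n.factorial : ℕ) : ℝ)⁻¹ • permSum a := by
  obtain ⟨l, hl⟩ : ∃ l, l = List.ofFn a := ⟨_, rfl⟩
  have hn : l.length = n := by simp [hl]
  subst hn
  have : a = l.get := List.ofFn_injective (by rw [← hl, List.ofFn_get])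
  rw [← hl, this]
  rfl

/-- The symmetrized product of `ν 0` copies of `z 0`, `ν 1` copies of `z 1` and `ν 2` copies of
`z 2`. -/
def symPow (z : Fin 3 → ℍ[ℝ]) (ν : Fin 3 →₀ ℕ) : ℍ[ℝ] :=
  symProd (List.replicate (ν 0) (z 0) ++ List.replicate (ν 1) (z 1) ++ List.replicate (ν 2) (z 2))

theorem fueter_eq_symPow (ν : Fin 3 →₀ ℕ) (x : ℍ[ℝ]) :
    fueter ν x = symPow (fun k => zetaFun k x) ν := rfl

theorem permSum_of_hasContent (z : Fin 3 → ℍ[ℝ]) {n : ℕ} {κ : Fin n → Fin 3} {ν : Fin 3 →₀ ℕ}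
    (h : HasContent κ ν) : permSum (z ∘ κ) = (n.factorial : ℝ) • symPow z ν := by
  set w : List (Fin 3) := List.replicate (ν 0) 0 ++ List.replicate (ν 1) 1 ++
    List.replicate (ν 2) 2 with hw
  have hc : HasContent w.get ν := by
    rw [HasContent, Fin.univ_val_map, List.ofFn_get]
    rw [Finsupp.toMultiset_apply, Finsupp.sum_fintype _ _ (by simp), Fin.sum_univ_three, hw]
    simp only [← Multiset.coe_add, Multiset.coe_replicate, Multiset.nsmul_singleton]
  have hn : w.length = n := by rw [hc.length, ← h.length]
  have h2 : symPow z ν = symProd (List.ofFn (z ∘ w.get)) := by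
    rw [← List.map_ofFn, List.ofFn_get, hw]
    simp [symPow]
  have h3 : ∀ {n' : ℕ} (κ' : Fin n' → Fin 3), HasContent κ' ν → n' = n →
      permSum (z ∘ κ) = (n.factorial : ℝ) • symProd (List.ofFn (z ∘ κ')) := by
    rintro n' κ' hκ' rfl
    obtain ⟨σ, hσ⟩ := h.exists_perm hκ'
    rw [symProd_ofFn, smul_inv_smul₀ (by positivity), ← hσ, ← Function.comp_assoc, permSum_comp]
  rw [h2]
  exact h3 _ hc hn

theorem symPow_zero (z : Fin 3 → ℍ[ℝ]) : symPow z 0 = 1 := by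
  simp [symPow, symProd]

theorem degree_sub_single {ν : Fin 3 →₀ ℕ} {k : Fin 3} {n : ℕ} (hk : ν k ≠ 0)
    (hn : ν.degree = n + 1) : (ν - Finsupp.single k 1).degree = n := by
  have h : ν - Finsupp.single k 1 + Finsupp.single k 1 = ν :=
    tsub_add_cancel_of_le (by simpa using Nat.one_le_iff_ne_zero.mpr hk)
  have := congrArg Finsupp.degree h
  rw [map_add, Finsupp.degree_single] at this
  omega

/-- The recursion of the symmetrized powers, from sorting the words by their first letter. -/
theorem degree_smul_symPow (z : Fin 3 → ℍ[ℝ]) (ν : Fin 3 →₀ ℕ) :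
    (ν.degree : ℝ) • symPow z ν =
      ∑ k, (ν k : ℝ) • (z k * symPow z (ν - Finsupp.single k 1)) := by
  rcases hn : ν.degree with _ | n
  · rw [Finsupp.degree_eq_zero_iff] at hn
    simp [hn]
  obtain ⟨κ, hκ⟩ := exists_hasContent ν hn
  have hrest : ∀ p, HasContent (fun i : Fin n => κ (Equiv.swap 0 p i.succ))
      (ν - Finsupp.single (κ p) 1) := by
    intro p
    have h1 : Finset.univ.val.map (κ ∘ Equiv.swap 0 p) = Finsupp.toMultiset ν := by
      rw [← hκ, ← Multiset.map_map]
      congr 1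
      simp
    have h2 : ν (κ p) ≠ 0 := by
      rw [← Finsupp.count_toMultiset, ← hκ, Multiset.count_ne_zero]
      exact Multiset.mem_map_of_mem κ (Finset.mem_univ p)
    have h3 : ν = ν - Finsupp.single (κ p) 1 + Finsupp.single (κ p) 1 :=
      (tsub_add_cancel_of_le (by simpa using Nat.one_le_iff_ne_zero.mpr h2)).symm
    rw [h3, map_add, Finsupp.toMultiset_single, one_smul, Fin.univ_val_map, List.ofFn_succ,
      ← Multiset.cons_coe, add_comm (Finsupp.toMultiset _), Multiset.singleton_add] at h1
    simp only [Function.comp, Equiv.swap_apply_left] at h1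
    rw [HasContent, Fin.univ_val_map]
    exact (Multiset.cons_inj_right _).mp h1
  have h1 := permSum_of_hasContent z hκ
  rw [permSum_succ] at h1
  have h4 : ∀ p, (z ∘ κ) p * permSum (fun i : Fin n => (z ∘ κ) (Equiv.swap 0 p i.succ)) =
      (n.factorial : ℝ) • (z (κ p) * symPow z (ν - Finsupp.single (κ p) 1)) := by
    intro p
    have := permSum_of_hasContent z (hrest p)
    simp only [Function.comp_def] at this ⊢
    rw [this, mul_smul_comm]
  rw [Finset.sum_congr rfl fun p _ => h4 p, ← Finset.smul_sum] at h1
  have h5 : ∑ p, (z (κ p) * symPow z (ν - Finsupp.single (κ p) 1)) =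
      ∑ k, (ν k : ℝ) • (z k * symPow z (ν - Finsupp.single k 1)) := by
    have h6 : ∀ F : Fin 3 → ℍ[ℝ], ∑ p, F (κ p) = ((Finsupp.toMultiset ν).map F).sum := by
      intro F
      rw [← hκ, Multiset.map_map]
      rfl
    rw [h6 fun k => z k * symPow z (ν - Finsupp.single k 1), Finsupp.toMultiset_apply,
      Finsupp.sum_fintype _ _ (by simp)]
    simp [Fin.sum_univ_three, Multiset.map_nsmul, Multiset.sum_nsmul, Nat.cast_smul_eq_nsmul]
  rw [← h5]
  have h7 : (n.factorial : ℝ) ≠ 0 := by positivity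
  apply smul_right_injective _ h7
  simp only
  rw [h1, Nat.factorial_succ, smul_smul, mul_comm]
  push_cast
  rfl

theorem norm_symPow_le {z : Fin 3 → ℍ[ℝ]} {r : ℝ} (hz : ∀ k, ‖z k‖ ≤ r) (ν : Fin 3 →₀ ℕ) :
    ‖symPow z ν‖ ≤ r ^ ν.degree := by
  have hr : 0 ≤ r := (norm_nonneg _).trans (hz 0)
  obtain ⟨n, hn⟩ : ∃ n, ν.degree = n := ⟨_, rfl⟩
  induction n generalizing ν with
  | zero => simp [(Finsupp.degree_eq_zero_iff ν).mp hn, symPow_zero]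
  | succ n ih =>
    have hpos : (0 : ℝ) < ν.degree := by rw [hn]; positivity
    have h := congrArg norm (degree_smul_symPow z ν)
    rw [norm_smul, Real.norm_of_nonneg hpos.le] at h
    refine le_of_mul_le_mul_left ?_ hpos
    rw [h]
    calc _ ≤ ∑ k, (ν k : ℝ) * r ^ ν.degree := by
          refine norm_sum_le_of_le _ fun k _ => ?_
          rw [norm_smul, norm_mul, Real.norm_of_nonneg (by positivity)]
          rcases eq_or_ne (ν k) 0 with h0 | h0
          · simp [h0]
          · have h1 := degree_sub_single h0 hn
            gcongr
            rw [hn, pow_succ']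
            have := ih _ h1
            rw [h1] at this
            exact mul_le_mul (hz k) this (norm_nonneg _) hr
      _ = _ := by
        rw [← Finset.sum_mul, Finsupp.degree_eq_sum]
        push_cast
        rfl

/-- Symmetrized powers of real numbers are monomials. -/
theorem symPow_coe (t : Fin 3 → ℝ) (ν : Fin 3 →₀ ℕ) :
    symPow (fun k => (t k : ℍ[ℝ])) ν = ((∏ k, t k ^ ν k : ℝ) : ℍ[ℝ]) := by
  obtain ⟨n, hn⟩ : ∃ n, ν.degree = n := ⟨_, rfl⟩
  induction n generalizing ν with
  | zero => simp [(Finsupp.degree_eq_zero_iff ν).mp hn, symPow_zero]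
  | succ n ih =>
    have hpos : (ν.degree : ℝ) ≠ 0 := by rw [hn]; positivity
    apply smul_right_injective _ hpos
    simp only
    rw [degree_smul_symPow]
    have h1 : ∀ k, (ν k : ℝ) • ((t k : ℍ[ℝ]) * symPow (fun k => (t k : ℍ[ℝ]))
        (ν - Finsupp.single k 1)) = (ν k : ℝ) • ((∏ k, t k ^ ν k : ℝ) : ℍ[ℝ]) := by
      intro k
      rcases eq_or_ne (ν k) 0 with h0 | h0
      · simp [h0]
      rw [ih _ (degree_sub_single h0 hn), ← Quaternion.coe_mul]
      congr 2
      obtain ⟨j, hj⟩ := Nat.exists_eq_succ_of_ne_zero h0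
      rw [← Finset.mul_prod_erase _ _ (Finset.mem_univ k),
        ← Finset.mul_prod_erase _ (fun i => t i ^ ν i) (Finset.mem_univ k), ← mul_assoc]
      congr 1
      · simp [hj, pow_succ']
      · refine Finset.prod_congr rfl fun i hi => ?_
        have : k ≠ i := (Finset.ne_of_mem_erase hi).symm
        simp [this]
    rw [Finset.sum_congr rfl fun k _ => h1 k, ← Finset.sum_smul, Finsupp.degree_eq_sum]
    push_cast
    rfl

/-! ### Differentiation of Fueter polynomials -/

/-- `ζₖ` as a continuous real linear map. -/
def zetaCLM (k : Fin 3) : ℍ[ℝ] →L[ℝ] ℍ[ℝ] := LinearMap.toContinuousLinearMap (zetaLin k)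

@[simp] theorem zetaCLM_apply (k : Fin 3) (v : ℍ[ℝ]) : zetaCLM k v = zetaFun k v := rfl

/-- The symmetrized products of the values of the `ζₖ` at two points do not depend on the order of
the points: the commutator of `ζₖ(x)` and `ζⱼ(v)` is antisymmetric in `k` and `j`. -/
theorem zetaFun_mul_add_mul (k j : Fin 3) (x v : ℍ[ℝ]) :
    zetaFun k x * zetaFun j v + zetaFun j x * zetaFun k v =
      zetaFun j v * zetaFun k x + zetaFun k v * zetaFun j x := by
  have h : ∀ (k : Fin 3) (x : ℍ[ℝ]),
      zetaFun k x = coord x k.succ • (1 : ℍ[ℝ]) - coord x 0 • e k.succ := by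
    intro k x
    rw [zetaFun, ← Algebra.algebraMap_eq_smul_one]
    rfl
  simp only [h, sub_mul, mul_sub, smul_mul_assoc, mul_smul_comm, one_mul, mul_one]
  module

theorem degree_smul_fueter (ν : Fin 3 →₀ ℕ) (x : ℍ[ℝ]) :
    (ν.degree : ℝ) • fueter ν x =
      ∑ k, (ν k : ℝ) • (zetaFun k x * fueter (ν - Finsupp.single k 1) x) :=
  degree_smul_symPow (fun k => zetaFun k x) ν

/-- The recursion of the Fueter polynomials with a factor `ζₖ(v)` at another point on the left:
both sides run over the same words, up to antisymmetric commutators. -/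
theorem sum_zetaFun_mul_sum (ν : Fin 3 →₀ ℕ) (x v : ℍ[ℝ]) :
    ∑ k, (ν k : ℝ) • (zetaFun k x * ∑ j, ((ν - Finsupp.single k 1 : Fin 3 →₀ ℕ) j : ℝ) •
        (zetaFun j v * fueter (ν - Finsupp.single k 1 - Finsupp.single j 1) x)) =
      ∑ j, (ν j : ℝ) • (zetaFun j v * ∑ k, ((ν - Finsupp.single j 1 : Fin 3 →₀ ℕ) k : ℝ) •
        (zetaFun k x * fueter (ν - Finsupp.single j 1 - Finsupp.single k 1) x)) := by
  set c : Fin 3 → Fin 3 → ℝ := fun k j => ν k * (ν - Finsupp.single k 1 : Fin 3 →₀ ℕ) j with hc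
  set G : Fin 3 → Fin 3 → ℍ[ℝ] :=
    fun k j => fueter (ν - Finsupp.single k 1 - Finsupp.single j 1) x with hG
  have hcs : ∀ k j, c k j = c j k := by
    intro k j
    rcases eq_or_ne k j with rfl | h
    · rfl
    · simp [hc, Finsupp.single_apply, h, h.symm, mul_comm]
  have hGs : ∀ k j, G k j = G j k := fun k j => by simp only [hG, tsub_right_comm]
  have h1 : ∀ (a b : Fin 3 → ℍ[ℝ]), ∑ k, (ν k : ℝ) • (a k *
      ∑ j, ((ν - Finsupp.single k 1 : Fin 3 →₀ ℕ) j : ℝ) •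
        (b j * fueter (ν - Finsupp.single k 1 - Finsupp.single j 1) x)) =
      ∑ k, ∑ j, c k j • (a k * b j * G k j) := by
    intro a b
    refine Finset.sum_congr rfl fun k _ => ?_
    rw [Finset.mul_sum, Finset.smul_sum]
    refine Finset.sum_congr rfl fun j _ => ?_
    rw [mul_smul_comm, smul_smul, mul_assoc]
  rw [h1 (fun k => zetaFun k x) fun k => zetaFun k v, h1 (fun k => zetaFun k v) fun k => zetaFun k x]
  set d : Fin 3 → Fin 3 → ℍ[ℝ] := fun k j =>
    c k j • (zetaFun k x * zetaFun j v * G k j) - c j k • (zetaFun j v * zetaFun k x * G j k) with hd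
  have hda : ∀ k j, d k j = - d j k := by
    intro k j
    have := congrArg (fun q => c k j • (q * G k j)) (zetaFun_mul_add_mul k j x v)
    simp only [add_mul, smul_add] at this
    simp only [hd, hcs j k, hGs j k]
    rw [neg_sub, sub_eq_sub_iff_add_eq_add, this, add_comm]
  have h2 : ∑ k, ∑ j, d k j = 0 := by
    have : ∑ k, ∑ j, d k j = - ∑ k, ∑ j, d k j := by
      conv_lhs => rw [Finset.sum_comm]
      rw [← Finset.sum_neg_distrib]
      refine Finset.sum_congr rfl fun k _ => ?_
      rw [← Finset.sum_neg_distrib]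
      exact Finset.sum_congr rfl fun j _ => hda j k
    have h := eq_neg_iff_add_eq_zero.mp this
    rw [← two_smul ℝ] at h
    exact (smul_eq_zero_iff_right two_ne_zero).mp h
  simp only [hd, Finset.sum_sub_distrib] at h2
  rw [sub_eq_zero.mp h2, Finset.sum_comm]

theorem hasFDerivAt_smul_sum_smul_mul {A : Type*} [NormedRing A] [NormedAlgebra ℝ A] {ι : Type*}
    [Fintype ι] {F : A → A} {z g : ι → A → A} {z' g' : ι → A →L[ℝ] A} {a : ι → ℝ} {b : ℝ} {x : A}
    {L : A →L[ℝ] A} (hF : F = fun y => b • ∑ k, a k • (z k y * g k y))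
    (h : ∀ k, a k ≠ 0 → HasFDerivAt (z k) (z' k) x ∧ HasFDerivAt (g k) (g' k) x)
    (hL : ∀ v, L v = b • ∑ k, a k • (z k x * g' k v + z' k v * g k x)) : HasFDerivAt F L x := by
  have h1 : HasFDerivAt (fun y => ∑ k, a k • (z k y * g k y))
      (∑ k, a k • (z k x • g' k + MulOpposite.op (g k x) • z' k)) x := by
    refine HasFDerivAt.fun_sum fun k _ => ?_
    rcases eq_or_ne (a k) 0 with h0 | h0
    · simp only [h0, zero_smul]
      refine (hasFDerivAt_const (𝕜 := ℝ) (0 : A) x).congr_fderiv ?_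
      exact ContinuousLinearMap.ext fun v => (zero_smul ℝ (z k x * g' k v + z' k v * g k x)).symm
    · exact ((h k h0).1.mul' (h k h0).2).fun_const_smul (a k)
  rw [hF]
  refine (h1.fun_const_smul b).congr_fderiv (ContinuousLinearMap.ext fun v => ?_)
  rw [hL]
  simp

/-- Termwise differentiation of a series `∑ fᵢ cᵢ` with constant factors `cᵢ`. -/
theorem exists_hasFDerivAt_tsum_mul {A : Type*} [NormedRing A] [NormedAlgebra ℝ A]
    [CompleteSpace A] {ι : Type*} {f : ι → A → A} {f' : ι → A → A →L[ℝ] A} {c : ι → A}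
    {u : ι → ℝ} {s : Set A} {x : A} (hu : Summable u) (hu0 : ∀ i, 0 ≤ u i) (hs : IsOpen s)
    (hs' : Convex ℝ s) (hf : ∀ i y, y ∈ s → HasFDerivAt (f i) (f' i y) y)
    (hf' : ∀ i y, y ∈ s → ∀ v, ‖f' i y v * c i‖ ≤ u i * ‖v‖) (hx : x ∈ s)
    (h0 : Summable fun i => f i x * c i) :
    ∃ L : A →L[ℝ] A, HasFDerivAt (fun y => ∑' i, f i y * c i) L x ∧
      ∀ v, HasSum (fun i => f' i x v * c i) (L v) := by
  have hbd : ∀ i y, y ∈ s → ‖MulOpposite.op (c i) • f' i y‖ ≤ u i := fun i y hy =>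
    ContinuousLinearMap.opNorm_le_bound _ (hu0 i) fun v => hf' i y hy v
  refine ⟨∑' i, MulOpposite.op (c i) • f' i x, ?_, fun v => ?_⟩
  · exact hasFDerivAt_tsum_of_isPreconnected hu hs hs'.isPreconnected
      (fun i y hy => (hf i y hy).mul_const' (c i)) hbd hx h0 hx
  · have hS : Summable fun i => MulOpposite.op (c i) • f' i x :=
      Summable.of_norm_bounded hu fun i => hbd i x hx
    exact hS.hasSum.mapL (ContinuousLinearMap.apply ℝ A v)

/-- The derivative `v ↦ ∑ₖ νₖ ζₖ(v) ζ^{ν - eₖ}(x)` of the Fueter polynomial `ζ^ν` at `x`. -/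
def fueterFDeriv (ν : Fin 3 →₀ ℕ) (x : ℍ[ℝ]) : ℍ[ℝ] →L[ℝ] ℍ[ℝ] :=
  ∑ k, (ν k : ℝ) • (MulOpposite.op (fueter (ν - Finsupp.single k 1) x) • zetaCLM k)

theorem fueterFDeriv_apply (ν : Fin 3 →₀ ℕ) (x v : ℍ[ℝ]) :
    fueterFDeriv ν x v =
      ∑ k, (ν k : ℝ) • (zetaFun k v * fueter (ν - Finsupp.single k 1) x) := by
  simp [fueterFDeriv]

theorem fueter_zero (x : ℍ[ℝ]) : fueter 0 x = 1 := symPow_zero fun k => zetaFun k x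

/-- Differentiating the recursion for `|ν| ζ^ν` gives the asserted derivative once directly and
`|ν| - 1` times by induction and `sum_zetaFun_mul_sum`. -/
theorem hasFDerivAt_fueter (ν : Fin 3 →₀ ℕ) (x : ℍ[ℝ]) :
    HasFDerivAt (fueter ν) (fueterFDeriv ν x) x := by
  obtain ⟨n, hn⟩ : ∃ n, ν.degree = n := ⟨_, rfl⟩
  induction n generalizing ν with
  | zero =>
    rw [(Finsupp.degree_eq_zero_iff ν).mp hn]
    have h1 : fueter 0 = fun _ => 1 := funext fun x => fueter_zero x
    have h2 : fueterFDeriv 0 x = 0 := by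
      ext1 v
      rw [fueterFDeriv_apply]
      simp
    rw [h1, h2]
    exact hasFDerivAt_const _ _
  | succ n ih =>
    have hpos : ((n + 1 : ℕ) : ℝ) ≠ 0 := by positivity
    have h1 : fueter ν = fun y => ((n + 1 : ℕ) : ℝ)⁻¹ •
        ∑ k, (ν k : ℝ) • (zetaFun k y * fueter (ν - Finsupp.single k 1) y) := by
      funext y
      rw [← degree_smul_fueter, hn, inv_smul_smul₀ hpos]
    refine hasFDerivAt_smul_sum_smul_mul (z' := zetaCLM)
      (g' := fun k => fueterFDeriv (ν - Finsupp.single k 1) x) h1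
      (fun k h0 => ⟨hasFDerivAt_zetaFun k x,
        ih _ (degree_sub_single (Nat.cast_ne_zero.mp h0) hn)⟩) fun v => ?_
    simp only [fueterFDeriv_apply, smul_add, Finset.sum_add_distrib, zetaCLM_apply]
    rw [← smul_add, eq_inv_smul_iff₀ hpos, sum_zetaFun_mul_sum, Nat.cast_succ, add_smul, one_smul,
      Finset.smul_sum]
    congr 1
    refine Finset.sum_congr rfl fun k _ => ?_
    rcases eq_or_ne (ν k) 0 with h0 | h0
    · simp [h0]
    · rw [← degree_smul_fueter, degree_sub_single h0 hn, mul_smul_comm, smul_comm]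

/-! ### Convergent Fueter series -/

/-- Formal power series in three central variables with quaternion coefficients. With the
Cauchy product they form the ring in which the Taylor coefficients `f_ν` multiply. -/
abbrev PS : Type := MvPowerSeries (Fin 3) ℍ[ℝ]

/-- The power series converges absolutely on some polydisc of positive radius. -/
def IsConv (c : PS) : Prop :=
  ∃ s : ℝ, 0 < s ∧ Summable fun ν : Fin 3 →₀ ℕ => s ^ ν.degree * ‖c ν‖

/-- The sum `∑_ν ζ^ν(x) c_ν` of a Fueter series. -/
def fueterSum (c : PS) (x : ℍ[ℝ]) : ℍ[ℝ] := ∑' ν, fueter ν x * c ν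

/-- The formal partial derivative of a power series in the variable `Xₖ`. -/
def dPS (k : Fin 3) (c : PS) : PS := fun ν => ((ν k + 1 : ℕ) : ℝ) • c (ν + Finsupp.single k 1)

theorem summable_fueter_mul {c : PS} {s : ℝ}
    (hc : Summable fun ν : Fin 3 →₀ ℕ => s ^ ν.degree * ‖c ν‖) {x : ℍ[ℝ]}
    (hx : ∀ k, ‖zetaFun k x‖ ≤ s) : Summable fun ν => fueter ν x * c ν := by
  refine Summable.of_norm_bounded hc fun ν => ?_
  rw [norm_mul]
  exact mul_le_mul_of_nonneg_right (norm_symPow_le hx ν) (norm_nonneg _)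

theorem nat_mul_half_pow_le {s : ℝ} (hs : 0 < s) (n : ℕ) :
    (n : ℝ) * (s / 2) ^ (n - 1) ≤ 2 / s * s ^ n := by
  rcases n with _ | n
  · simp; positivity
  · have h1 : ((n + 1 : ℕ) : ℝ) ≤ 2 ^ (n + 1) := by exact_mod_cast Nat.lt_two_pow_self.le
    have h2 : 2 / s * s ^ (n + 1) = 2 ^ (n + 1) * (s / 2) ^ n := by
      rw [div_pow, pow_succ, pow_succ]
      field_simp
    rw [h2, Nat.add_sub_cancel]
    gcongr

theorem summable_dPS {c : PS} {s : ℝ} (hs : 0 < s)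
    (hc : Summable fun ν : Fin 3 →₀ ℕ => s ^ ν.degree * ‖c ν‖) (k : Fin 3) :
    Summable fun ν : Fin 3 →₀ ℕ => (s / 2) ^ ν.degree * ‖dPS k c ν‖ := by
  have h1 := (hc.comp_injective (add_left_injective (Finsupp.single k 1))).mul_left (2 / s)
  refine Summable.of_nonneg_of_le (fun ν => by positivity) (fun ν => ?_) h1
  simp only [dPS, norm_smul, Function.comp, map_add, Finsupp.degree_single]
  have h2 := nat_mul_half_pow_le hs (ν.degree + 1)
  rw [Nat.add_sub_cancel] at h2
  have h3 : ((ν k + 1 : ℕ) : ℝ) ≤ ((ν.degree + 1 : ℕ) : ℝ) := by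
    exact_mod_cast Nat.add_le_add_right (Finsupp.le_degree k ν) 1
  rw [Real.norm_of_nonneg (by positivity), ← mul_assoc, ← mul_assoc]
  refine mul_le_mul_of_nonneg_right (le_trans ?_ h2) (norm_nonneg _)
  rw [mul_comm]
  gcongr

theorem IsConv.dPS {c : PS} (hc : IsConv c) (k : Fin 3) : IsConv (dPS k c) := by
  obtain ⟨s, hs, h⟩ := hc
  exact ⟨s / 2, by positivity, summable_dPS hs h k⟩

/-- The neighbourhood of the origin on which all the `ζₖ` are smaller than `r`. -/
def zetaBall (r : ℝ) : Set ℍ[ℝ] := ⋂ k, zetaCLM k ⁻¹' Metric.ball 0 r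

theorem mem_zetaBall {r : ℝ} {x : ℍ[ℝ]} : x ∈ zetaBall r ↔ ∀ k, ‖zetaFun k x‖ < r := by
  simp [zetaBall]

theorem isOpen_zetaBall (r : ℝ) : IsOpen (zetaBall r) :=
  isOpen_iInter_of_finite fun k => Metric.isOpen_ball.preimage (zetaCLM k).continuous

theorem convex_zetaBall (r : ℝ) : Convex ℝ (zetaBall r) :=
  convex_iInter fun k => (convex_ball _ _).linear_preimage (zetaCLM k).toLinearMap

theorem zetaFun_zero (k : Fin 3) : zetaFun k 0 = 0 := (zetaCLM k).map_zero

theorem zero_mem_zetaBall {r : ℝ} (hr : 0 < r) : (0 : ℍ[ℝ]) ∈ zetaBall r :=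
  mem_zetaBall.mpr fun k => by rwa [zetaFun_zero, norm_zero]

theorem zetaBall_mem_nhds {r : ℝ} (hr : 0 < r) : zetaBall r ∈ 𝓝 (0 : ℍ[ℝ]) :=
  (isOpen_zetaBall r).mem_nhds (zero_mem_zetaBall hr)

theorem norm_fueterFDeriv_le {r : ℝ} {x : ℍ[ℝ]} (hx : ∀ k, ‖zetaFun k x‖ ≤ r)
    (ν : Fin 3 →₀ ℕ) (v : ℍ[ℝ]) :
    ‖fueterFDeriv ν x v‖ ≤ ν.degree * r ^ (ν.degree - 1) * ∑ k, ‖zetaFun k v‖ := by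
  have hr : 0 ≤ r := (norm_nonneg _).trans (hx 0)
  rw [fueterFDeriv_apply, Finset.mul_sum]
  refine norm_sum_le_of_le _ fun k _ => ?_
  rw [norm_smul, Real.norm_of_nonneg (by positivity)]
  rcases eq_or_ne (ν k) 0 with h0 | h0
  · rw [h0, Nat.cast_zero, zero_mul]; positivity
  obtain ⟨n, hn⟩ : ∃ n, ν.degree = n + 1 :=
    Nat.exists_eq_succ_of_ne_zero fun h => h0 (by rw [(Finsupp.degree_eq_zero_iff ν).mp h]; rfl)
  have h1 : ‖fueter (ν - Finsupp.single k 1) x‖ ≤ r ^ (ν.degree - 1) := by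
    have := norm_symPow_le hx (ν - Finsupp.single k 1)
    rwa [degree_sub_single h0 hn, ← Nat.add_sub_cancel (n := n) (m := 1), ← hn] at this
  rw [norm_mul, mul_comm ‖zetaFun k v‖, ← mul_assoc]
  gcongr
  exact Finsupp.le_degree k ν

theorem exists_norm_zetaFun_le : ∃ K : ℝ, 0 ≤ K ∧ ∀ v, ∑ k, ‖zetaFun k v‖ ≤ K * ‖v‖ := by
  refine ⟨∑ k, ‖zetaCLM k‖, by positivity, fun v => ?_⟩
  rw [Finset.sum_mul]
  exact Finset.sum_le_sum fun k _ => (zetaCLM k).le_opNorm v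

theorem hasSum_fueterFDeriv_mul {c : PS} {x : ℍ[ℝ]} (v : ℍ[ℝ])
    (hx : ∀ k, Summable fun ν => fueter ν x * dPS k c ν) :
    HasSum (fun ν => fueterFDeriv ν x v * c ν) (∑ k, zetaFun k v * fueterSum (dPS k c) x) := by
  simp only [fueterFDeriv_apply, Finset.sum_mul]
  refine hasSum_sum fun k _ => ?_
  have h1 := ((hx k).hasSum).mul_left (zetaFun k v)
  have hinj := add_left_injective (Finsupp.single k 1 : Fin 3 →₀ ℕ)
  rw [← hinj.hasSum_iff]
  · refine h1.congr_fun fun ν => ?_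
    simp [dPS, mul_assoc]
  · intro ν hν
    have h0 : ν k = 0 := by
      by_contra h
      exact hν ⟨ν - Finsupp.single k 1,
        tsub_add_cancel_of_le (by simpa using Nat.one_le_iff_ne_zero.mpr h)⟩
    simp [h0]

/-- Termwise differentiation of a convergent Fueter series. -/
theorem hasFDerivAt_fueterSum {c : PS} {s : ℝ} (hs : 0 < s)
    (hc : Summable fun ν : Fin 3 →₀ ℕ => s ^ ν.degree * ‖c ν‖) {x : ℍ[ℝ]}
    (hx : x ∈ zetaBall (s / 2)) :
    ∃ L : ℍ[ℝ] →L[ℝ] ℍ[ℝ], HasFDerivAt (fueterSum c) L x ∧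
      ∀ v, L v = ∑ k, zetaFun k v * fueterSum (dPS k c) x := by
  obtain ⟨K, hK, hKv⟩ := exists_norm_zetaFun_le
  have hbd : ∀ (ν : Fin 3 →₀ ℕ) (y : ℍ[ℝ]), y ∈ zetaBall (s / 2) → ∀ v,
      ‖fueterFDeriv ν y v * c ν‖ ≤ K * (2 / s) * (s ^ ν.degree * ‖c ν‖) * ‖v‖ := by
    intro ν y hy v
    rw [norm_mul]
    have h1 := norm_fueterFDeriv_le (fun k => (mem_zetaBall.mp hy k).le) ν v
    have h2 := nat_mul_half_pow_le hs ν.degree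
    calc _ ≤ (2 / s * s ^ ν.degree) * (K * ‖v‖) * ‖c ν‖ := by
          gcongr
          exact h1.trans (mul_le_mul h2 (hKv v) (by positivity) (by positivity))
      _ = _ := by ring
  obtain ⟨L, hL, hLv⟩ := exists_hasFDerivAt_tsum_mul (hc.mul_left (K * (2 / s)))
    (fun ν => by positivity) (isOpen_zetaBall (s / 2)) (convex_zetaBall (s / 2))
    (fun ν y _ => hasFDerivAt_fueter ν y) hbd hx
    (summable_fueter_mul hc fun k => (mem_zetaBall.mp hx k).le.trans (by linarith))
  refine ⟨L, hL, fun v => (hLv v).unique (hasSum_fueterFDeriv_mul v fun k => ?_)⟩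
  exact summable_fueter_mul (summable_dPS hs hc k) fun k => (mem_zetaBall.mp hx k).le

theorem sum_e_mul_zetaFun_e (k : Fin 3) : ∑ i, e i * zetaFun k (e i) = 0 := by
  obtain ⟨x, hx, h⟩ := (hyperholoNearZero_zetaFun k).exists
  simpa [partialDeriv, (hasFDerivAt_zetaFun k x).fderiv, zetaLin] using h

theorem zetaFun_e_succ (k j : Fin 3) : zetaFun k (e j.succ) = if k = j then 1 else 0 := by
  fin_cases k <;> fin_cases j <;> ext <;>
  simp only [zetaFun, Quaternion.re_sub, Quaternion.imI_sub, Quaternion.imJ_sub,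
    Quaternion.imK_sub, Quaternion.re_smul, Quaternion.imI_smul, Quaternion.imJ_smul,
    Quaternion.imK_smul] <;>
  simp [coord, e]

theorem partialDeriv_succ_fueterSum {c : PS} {s : ℝ} (hs : 0 < s)
    (hc : Summable fun ν : Fin 3 →₀ ℕ => s ^ ν.degree * ‖c ν‖) {x : ℍ[ℝ]}
    (hx : x ∈ zetaBall (s / 2)) (k : Fin 3) :
    partialDeriv k.succ (fueterSum c) x = fueterSum (dPS k c) x := by
  obtain ⟨L, hL, hLv⟩ := hasFDerivAt_fueterSum hs hc hx
  rw [partialDeriv, hL.fderiv, hLv]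
  simp [zetaFun_e_succ]

theorem hyperholoNearZero_fueterSum {c : PS} (hc : IsConv c) :
    HyperholoNearZero (fueterSum c) := by
  obtain ⟨s, hs, h⟩ := hc
  filter_upwards [zetaBall_mem_nhds (half_pos hs)] with x hx
  obtain ⟨L, hd, hLv⟩ := hasFDerivAt_fueterSum hs h hx
  refine ⟨hd.differentiableAt, ?_⟩
  simp only [partialDeriv, hd.fderiv, hLv, Finset.mul_sum, ← mul_assoc]
  rw [Finset.sum_comm]
  simp only [← Finset.sum_mul, sum_e_mul_zetaFun_e, zero_mul, Finset.sum_const_zero]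

/-- The hyperholomorphic germ with a given convergent Fueter series. -/
def ofPS (c : PS) (hc : IsConv c) : OH :=
  ⟨(fueterSum c : QGerm), fueterSum c, rfl, hyperholoNearZero_fueterSum hc⟩

theorem germDeriv_fueterSum {c : PS} (hc : IsConv c) (k : Fin 3) :
    germDeriv k.succ (fueterSum c : QGerm) = (fueterSum (dPS k c) : QGerm) := by
  obtain ⟨s, hs, h⟩ := hc
  refine Filter.Germ.coe_eq.mpr ?_
  filter_upwards [zetaBall_mem_nhds (half_pos hs)] with x hx
  exact partialDeriv_succ_fueterSum hs h hx k

theorem fueter_coe (ν : Fin 3 →₀ ℕ) {x : ℍ[ℝ]} (t : Fin 3 → ℝ)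
    (hx : ∀ k, zetaFun k x = (t k : ℍ[ℝ])) :
    fueter ν x = ((∏ k, t k ^ ν k : ℝ) : ℍ[ℝ]) := by
  rw [fueter_eq_symPow, funext hx, symPow_coe]

theorem fueterSum_zero (c : PS) : fueterSum c 0 = c 0 := by
  rw [fueterSum, tsum_eq_single 0, fueter_zero, one_mul]
  intro ν hν
  obtain ⟨k, hk⟩ := Finsupp.ne_iff.mp hν
  rw [fueter_coe ν 0 (by simp [zetaFun_zero]), Finset.prod_eq_zero (Finset.mem_univ k)]
  · simp
  · simpa using hk

theorem iterate_germDeriv_fueterSum {c : PS} (hc : IsConv c) (k : Fin 3) (n : ℕ) :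
    IsConv ((dPS k)^[n] c) ∧ (germDeriv k.succ)^[n] (fueterSum c : QGerm) =
      (fueterSum ((dPS k)^[n] c) : QGerm) := by
  induction n with
  | zero => exact ⟨hc, rfl⟩
  | succ n ih =>
    simp only [Function.iterate_succ_apply']
    exact ⟨ih.1.dPS k, by rw [ih.2, germDeriv_fueterSum ih.1]⟩

theorem iterate_dPS_apply (k : Fin 3) (n : ℕ) (c : PS) (ν : Fin 3 →₀ ℕ) :
    (dPS k)^[n] c ν = (((ν k + 1).ascFactorial n : ℕ) : ℝ) • c (ν + Finsupp.single k n) := by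
  induction n generalizing c with
  | zero => simp
  | succ n ih =>
    rw [Function.iterate_succ_apply, ih, dPS, smul_smul, add_assoc, ← Finsupp.single_add,
      Nat.ascFactorial_succ]
    congr 1
    simp
    ring

theorem coeff_of_eq_fueterSum {f : OH} {c : PS} (hc : IsConv c)
    (hf : (f : QGerm) = (fueterSum c : QGerm)) (ν : Fin 3 →₀ ℕ) : coeff ν f = c ν := by
  rw [coeff, hf]
  have h3 := iterate_germDeriv_fueterSum hc 2 (ν 2)
  have h2 := iterate_germDeriv_fueterSum h3.1 1 (ν 1)
  have h1 := iterate_germDeriv_fueterSum h2.1 0 (ν 0)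
  have h : (germDeriv 1)^[ν 0] ((germDeriv 2)^[ν 1] ((germDeriv 3)^[ν 2]
      (fueterSum c : QGerm))) = _ :=
    (congrArg (fun q => (germDeriv 1)^[ν 0] ((germDeriv 2)^[ν 1] q)) h3.2).trans
      ((congrArg (fun q => (germDeriv 1)^[ν 0] q) h2.2).trans h1.2)
  rw [h, Filter.Germ.value_ofFun, fueterSum_zero]
  simp only [iterate_dPS_apply]
  have hν : (0 + Finsupp.single 0 (ν 0) + Finsupp.single 1 (ν 1) + Finsupp.single 2 (ν 2) :
      Fin 3 →₀ ℕ) = ν := by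
    ext k
    fin_cases k <;> simp
  rw [hν, smul_smul, smul_smul, smul_smul]
  convert one_smul ℝ (c ν)
  have hne : ((∏ k, (ν k).factorial : ℕ) : ℝ) ≠ 0 := by
    exact_mod_cast Finset.prod_ne_zero_iff.mpr fun k _ => Nat.factorial_ne_zero _
  rw [mul_assoc, mul_assoc, inv_mul_eq_one₀ hne]
  simp [Fin.prod_univ_three, Nat.one_ascFactorial, mul_assoc]

/-- The germ `f` is the sum near the origin of the Fueter series with coefficients `c`. -/
def HasFueterSeries (f : OH) (c : PS) : Prop :=
  ∃ F : ℍ[ℝ] → ℍ[ℝ], (f : QGerm) = (F : QGerm) ∧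
    ∀ᶠ x in 𝓝 (0 : ℍ[ℝ]), HasSum (fun ν => fueter ν x * c ν) (F x)

/-- The Taylor coefficients `f_ν`, as a power series. -/
def ser (f : OH) : PS := fun ν => coeff ν f

theorem isCKProd_iff {f g h : OH} : IsCKProd f g h ↔ HasFueterSeries h (ser f * ser g) := by
  have : ∀ η, (ser f * ser g) η =
      ∑ p ∈ Finset.HasAntidiagonal.antidiagonal η, coeff p.1 f * coeff p.2 g :=
    fun η => MvPowerSeries.coeff_mul η (ser f) (ser g)
  simp only [HasFueterSeries, this, IsCKProd]

/-- The point `r (e₁ + e₂ + e₃)`. -/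
def octantPt (r : ℝ) : ℍ[ℝ] := ⟨0, r, r, r⟩

/-- Convergence at one point of the positive octant of the hyperplane `x₀ = 0` gives absolute
convergence on a polydisc. -/
theorem HasFueterSeries.isConv {f : OH} {c : PS} (h : HasFueterSeries f c) : IsConv c := by
  obtain ⟨F, -, hF⟩ := h
  have hcont : Filter.Tendsto (fun r : ℝ => octantPt r) (𝓝[>] 0) (𝓝 0) := by
    have h1 : (fun r : ℝ => octantPt r) = fun r => r • octantPt 1 := by
      funext r
      ext <;> simp only [Quaternion.re_smul, Quaternion.imI_smul, Quaternion.imJ_smul,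
        Quaternion.imK_smul] <;> simp [octantPt]
    rw [h1]
    have h2 : Continuous fun r : ℝ => r • octantPt 1 := by fun_prop
    simpa only [zero_smul] using (h2.tendsto 0).mono_left (nhdsWithin_le_nhds (s := Set.Ioi 0))
  obtain ⟨r, hr, hr0⟩ := ((hcont.eventually hF).and self_mem_nhdsWithin).exists
  refine ⟨r, hr0, ?_⟩
  have hz : ∀ k, zetaFun k (octantPt r) = ((r : ℝ) : ℍ[ℝ]) := by
    intro k
    fin_cases k <;> simp [zetaFun, coord, octantPt]
  have := summable_norm_iff.mpr hr.summable
  refine this.congr fun ν => ?_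
  rw [fueter_coe ν (fun _ => r) hz, norm_mul, Quaternion.norm_coe, Finset.prod_pow_eq_pow_sum,
    ← Finsupp.degree_eq_sum, Real.norm_of_nonneg (pow_nonneg hr0.le _)]

theorem HasFueterSeries.eq_fueterSum {f : OH} {c : PS} (h : HasFueterSeries f c) :
    (f : QGerm) = (fueterSum c : QGerm) := by
  obtain ⟨F, hf, hF⟩ := h
  rw [hf]
  exact Filter.Germ.coe_eq.mpr (hF.mono fun x hx => hx.tsum_eq.symm)

theorem HasFueterSeries.ser_eq {f : OH} {c : PS} (h : HasFueterSeries f c) : ser f = c :=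
  funext fun ν => coeff_of_eq_fueterSum h.isConv h.eq_fueterSum ν

theorem HasFueterSeries.unique {f g : OH} {c : PS} (hf : HasFueterSeries f c)
    (hg : HasFueterSeries g c) : f = g :=
  Subtype.ext (hf.eq_fueterSum.trans hg.eq_fueterSum.symm)

theorem hasFueterSeries_ofPS {c : PS} (hc : IsConv c) : HasFueterSeries (ofPS c hc) c := by
  refine ⟨fueterSum c, rfl, ?_⟩
  obtain ⟨s, hs, h⟩ := hc
  filter_upwards [zetaBall_mem_nhds hs] with x hx
  exact (summable_fueter_mul h fun k => (mem_zetaBall.mp hx k).le).hasSum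

theorem HasFueterSeries.add {f g : OH} {c d : PS} (hf : HasFueterSeries f c)
    (hg : HasFueterSeries g d) : HasFueterSeries (f + g) (c + d) := by
  obtain ⟨F, hF, hF'⟩ := hf
  obtain ⟨G, hG, hG'⟩ := hg
  refine ⟨F + G, ?_, ?_⟩
  · rw [Submodule.coe_add, hF, hG]; rfl
  · filter_upwards [hF', hG'] with x h1 h2
    exact (h1.add h2).congr_fun fun ν => mul_add _ _ _

theorem HasFueterSeries.op_smul {f : OH} {c : PS} (hf : HasFueterSeries f c) (a : ℍ[ℝ]) :
    HasFueterSeries (MulOpposite.op a • f) (c * MvPowerSeries.C a) := by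
  obtain ⟨F, hF, hF'⟩ := hf
  refine ⟨fun x => F x * a, ?_, ?_⟩
  · rw [Submodule.coe_smul, hF]; rfl
  · filter_upwards [hF'] with x h1
    refine (h1.mul_right a).congr_fun fun ν => ?_
    rw [mul_assoc]
    congr 1
    exact MvPowerSeries.coeff_mul_C ν c a

theorem hasFueterSeries_monomial {F : ℍ[ℝ] → ℍ[ℝ]} {f : OH} (hf : (f : QGerm) = (F : QGerm))
    (ν : Fin 3 →₀ ℕ) (a : ℍ[ℝ]) (hF : ∀ x, F x = fueter ν x * a) :
    HasFueterSeries f (MvPowerSeries.monomial ν a) := by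
  refine ⟨F, hf, Filter.Eventually.of_forall fun x => ?_⟩
  rw [hF]
  convert hasSum_single ν ?_ using 2
  · exact (MvPowerSeries.coeff_monomial_same ν a).symm
  · intro μ hμ
    exact mul_eq_zero_of_right _ (MvPowerSeries.coeff_monomial_ne hμ a)

theorem hasFueterSeries_const (a : ℍ[ℝ]) : HasFueterSeries (const a) (MvPowerSeries.C a) :=
  hasFueterSeries_monomial (F := fun _ => a) rfl 0 a fun x => by rw [fueter_zero, one_mul]

theorem fueter_single (k : Fin 3) (x : ℍ[ℝ]) : fueter (Finsupp.single k 1) x = zetaFun k x := by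
  have h := degree_smul_fueter (Finsupp.single k 1) x
  rw [Finsupp.degree_single, Nat.cast_one, one_smul, Finset.sum_eq_single k] at h
  · simpa [fueter_zero] using h
  · intro j _ hj
    simp [hj.symm]
  · simp

theorem hasFueterSeries_zeta (k : Fin 3) : HasFueterSeries (zeta k) (MvPowerSeries.X k) :=
  hasFueterSeries_monomial (F := zetaFun k) rfl _ 1 fun x => by rw [fueter_single, mul_one]

theorem val_eq (f : OH) : val f = MvPowerSeries.constantCoeff (ser f) := by
  change _ = coeff 0 f
  simp [val, coeff]

/-! ### The ring of convergent power series -/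

theorem summable_pow_degree {r : ℝ} (h0 : 0 ≤ r) (h1 : r < 1) :
    Summable fun ν : Fin 3 →₀ ℕ => r ^ ν.degree := by
  have h : ∀ n : ℕ, Summable fun ν : Fin n → ℕ => ∏ k, r ^ ν k := by
    intro n
    induction n with
    | zero => exact (hasSum_fintype _).summable
    | succ n ih =>
      rw [← (Fin.consEquiv fun _ : Fin (n + 1) => ℕ).summable_iff]
      have := (summable_geometric_of_lt_one h0 h1).mul_of_nonneg ih
        (fun _ => by positivity) fun _ => by positivity
      refine this.congr fun p => ?_
      simp [Fin.prod_univ_succ, Fin.consEquiv]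
  rw [← Finsupp.equivFunOnFinite.symm.summable_iff]
  refine (h 3).congr fun ν => ?_
  rw [Finset.prod_pow_eq_pow_sum, Function.comp, Finsupp.degree_eq_sum]
  rfl

theorem summable_pow_degree_mul_mono {c : PS} {s t : ℝ} (ht : 0 ≤ t) (hts : t ≤ s)
    (h : Summable fun ν : Fin 3 →₀ ℕ => s ^ ν.degree * ‖c ν‖) :
    Summable fun ν : Fin 3 →₀ ℕ => t ^ ν.degree * ‖c ν‖ :=
  Summable.of_nonneg_of_le (fun ν => by positivity) (fun ν => by gcongr) h

theorem PS.mul_apply (c d : PS) (η : Fin 3 →₀ ℕ) :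
    (c * d) η = ∑ p ∈ Finset.HasAntidiagonal.antidiagonal η, c p.1 * d p.2 :=
  MvPowerSeries.coeff_mul η c d

theorem pow_degree_mul_norm_mul_le (c d : PS) {s : ℝ} (hs : 0 ≤ s) (η : Fin 3 →₀ ℕ) :
    s ^ η.degree * ‖(c * d) η‖ ≤ ∑ p ∈ Finset.HasAntidiagonal.antidiagonal η,
      (s ^ p.1.degree * ‖c p.1‖) * (s ^ p.2.degree * ‖d p.2‖) := by
  rw [PS.mul_apply]
  calc _ ≤ s ^ η.degree * ∑ p ∈ Finset.HasAntidiagonal.antidiagonal η, ‖c p.1‖ * ‖d p.2‖ := by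
        gcongr
        exact norm_sum_le_of_le _ fun p _ => (norm_mul _ _).le
    _ = _ := by
        rw [Finset.mul_sum]
        refine Finset.sum_congr rfl fun p hp => ?_
        rw [← Finset.HasAntidiagonal.mem_antidiagonal.mp hp, map_add, pow_add]
        ring

theorem IsConv.mul {c d : PS} (hc : IsConv c) (hd : IsConv d) : IsConv (c * d) := by
  obtain ⟨s, hs, h⟩ := hc
  obtain ⟨t, ht, h'⟩ := hd
  have hm : 0 < min s t := lt_min hs ht
  refine ⟨min s t, hm, ?_⟩
  refine Summable.of_nonneg_of_le (fun ν => by positivity)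
    (fun η => pow_degree_mul_norm_mul_le c d hm.le η) ?_
  have hsum := (summable_pow_degree_mul_mono hm.le (min_le_left s t) h).mul_of_nonneg
    (summable_pow_degree_mul_mono hm.le (min_le_right s t) h')
    (fun _ => by positivity) fun _ => by positivity
  exact summable_sum_mul_antidiagonal_of_summable_mul
    (f := fun ν : Fin 3 →₀ ℕ => min s t ^ ν.degree * ‖c ν‖)
    (g := fun ν : Fin 3 →₀ ℕ => min s t ^ ν.degree * ‖d ν‖) hsum

theorem isConv_C (a : ℍ[ℝ]) : IsConv (MvPowerSeries.C a) := (hasFueterSeries_const a).isConv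

theorem isConv_X (k : Fin 3) : IsConv (MvPowerSeries.X k) := (hasFueterSeries_zeta k).isConv

theorem IsConv.add {c d : PS} (hc : IsConv c) (hd : IsConv d) : IsConv (c + d) :=
  ((hasFueterSeries_ofPS hc).add (hasFueterSeries_ofPS hd)).isConv

theorem IsConv.neg {c : PS} (hc : IsConv c) : IsConv (-c) := by
  simpa using (isConv_C (-1)).mul hc

/-- A geometric majorant: if `u(0) = 0` and `u` is convergent, then the solution of `g = 1 + u g`
is convergent. -/
theorem isConv_of_eq_one_add_mul {u g : PS} (hu : IsConv u) (hu0 : u 0 = 0) (hg : g = 1 + u * g) :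
    IsConv g := by
  obtain ⟨s₀, hs₀, h₀⟩ := hu
  set M := ∑' ν : Fin 3 →₀ ℕ, s₀ ^ ν.degree * ‖u ν‖ with hM
  have hM0 : 0 ≤ M := tsum_nonneg fun ν => by positivity
  -- this radius makes the sum of the absolute values of the terms of `u` at most `1 / 2`
  set t : ℝ := 1 / (2 * (M + 1)) with ht
  have ht0 : 0 < t := by positivity
  have ht1 : t ≤ 1 := by
    rw [ht, div_le_one (by positivity)]
    linarith
  have htM : t * M ≤ 1 / 2 := by
    rw [ht, div_mul_eq_mul_div, div_le_div_iff₀ (by positivity) (by positivity)]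
    linarith
  have hs : 0 < t * s₀ := by positivity
  set w : (Fin 3 →₀ ℕ) → ℝ := fun ν => (t * s₀) ^ ν.degree * ‖u ν‖ with hw
  have hw0 : ∀ ν, 0 ≤ w ν := fun ν => by positivity
  have hwle : ∀ ν, w ν ≤ t * (s₀ ^ ν.degree * ‖u ν‖) := by
    intro ν
    rcases eq_or_ne ν 0 with rfl | hν
    · simp [hw, hu0]
    · have h1 : ν.degree ≠ 0 := fun h => hν ((Finsupp.degree_eq_zero_iff ν).mp h)
      rw [hw]
      simp only
      rw [mul_pow, mul_assoc]
      gcongr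
      exact pow_le_of_le_one ht0.le ht1 h1
  have hwsum : Summable w := Summable.of_nonneg_of_le hw0 hwle (h₀.mul_left t)
  have hw2 : ∑' ν, w ν ≤ 1 / 2 := by
    refine (hwsum.tsum_le_tsum hwle (h₀.mul_left t)).trans ?_
    rw [tsum_mul_left]
    exact htM
  have hbd : ∀ (n : ℕ) (η : Fin 3 →₀ ℕ), η.degree = n → (t * s₀) ^ η.degree * ‖g η‖ ≤ 2 := by
    intro n
    induction n using Nat.strong_induction_on with
    | _ n ih =>
      intro η hη
      have h1 : (t * s₀) ^ η.degree * ‖(1 : PS) η‖ ≤ 1 := by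
        rcases eq_or_ne η 0 with rfl | h
        · have : (1 : PS) 0 = 1 := by
            have := MvPowerSeries.coeff_one (R := ℍ[ℝ]) (0 : Fin 3 →₀ ℕ)
            rwa [if_pos rfl] at this
          simp [this]
        · have : (1 : PS) η = 0 := by
            have := MvPowerSeries.coeff_one (R := ℍ[ℝ]) η
            rwa [if_neg h] at this
          simp [this]
      have h2 : (t * s₀) ^ η.degree * ‖(u * g) η‖ ≤ 1 := by
        calc _ ≤ _ := pow_degree_mul_norm_mul_le u g hs.le η
          _ ≤ ∑ p ∈ Finset.HasAntidiagonal.antidiagonal η, w p.1 * 2 := by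
            refine Finset.sum_le_sum fun p hp => ?_
            rcases eq_or_ne p.1 0 with h | h
            · simp [hw, h, hu0]
            · refine mul_le_mul_of_nonneg_left (ih p.2.degree ?_ p.2 rfl) (hw0 _)
              have h3 : p.1.degree ≠ 0 := fun h' => h ((Finsupp.degree_eq_zero_iff _).mp h')
              have h4 := congrArg Finsupp.degree (Finset.HasAntidiagonal.mem_antidiagonal.mp hp)
              rw [map_add] at h4
              omega
          _ ≤ _ := by
            rw [← Finset.sum_mul]
            have h3 : ∑ p ∈ Finset.HasAntidiagonal.antidiagonal η, w p.1 ≤ ∑' ν, w ν := by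
              rw [← Finset.sum_image (g := Prod.fst) (f := w)]
              · exact hwsum.sum_le_tsum _ fun ν _ => hw0 ν
              · intro p hp q hq hpq
                have hp' := Finset.HasAntidiagonal.mem_antidiagonal.mp (Finset.mem_coe.mp hp)
                have hq' := Finset.HasAntidiagonal.mem_antidiagonal.mp (Finset.mem_coe.mp hq)
                have hpq' : p.1 = q.1 := hpq
                refine Prod.ext hpq' (add_left_cancel (a := p.1) ?_)
                rw [hp', hpq', hq']
            linarith
      have h3 : g η = (1 : PS) η + (u * g) η := congrFun hg η
      calc _ ≤ (t * s₀) ^ η.degree * (‖(1 : PS) η‖ + ‖(u * g) η‖) := by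
            gcongr
            rw [h3]
            exact norm_add_le _ _
        _ ≤ 2 := by rw [mul_add]; linarith
  refine ⟨t * s₀ / 2, by positivity, ?_⟩
  refine Summable.of_nonneg_of_le (fun ν => by positivity) (fun ν => ?_)
    ((summable_pow_degree (r := 1 / 2) (by norm_num) (by norm_num)).mul_left 2)
  have := hbd _ ν rfl
  calc _ = (1 / 2) ^ ν.degree * ((t * s₀) ^ ν.degree * ‖g ν‖) := by
        rw [← mul_assoc, ← mul_pow]
        ring
    _ ≤ (1 / 2) ^ ν.degree * 2 := by gcongr
    _ = _ := mul_comm _ _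

/-- A convergent power series that does not vanish at the origin has a convergent inverse. -/
theorem IsConv.exists_inv {f : PS} (hf : IsConv f) (h0 : MvPowerSeries.constantCoeff f ≠ 0) :
    ∃ g : PS, IsConv g ∧ f * g = 1 ∧ g * f = 1 := by
  set a := MvPowerSeries.constantCoeff f with ha
  set g := MvPowerSeries.invOfUnit f (Units.mk0 a h0) with hg
  have h1 : f * g = 1 := MvPowerSeries.mul_invOfUnit _ _ rfl
  have h2 : g * f = 1 := MvPowerSeries.invOfUnit_mul _ _ rfl
  refine ⟨g, ?_, h1, h2⟩
  have hC : (MvPowerSeries.C a⁻¹ : PS) * MvPowerSeries.C a = 1 := by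
    rw [← map_mul, inv_mul_cancel₀ h0, map_one]
  have hC' : (MvPowerSeries.C a : PS) * MvPowerSeries.C a⁻¹ = 1 := by
    rw [← map_mul, mul_inv_cancel₀ h0, map_one]
  -- the normalization `a⁻¹ f = 1 - u` with `u(0) = 0`, whose inverse is `g a`
  have hconv : IsConv (g * MvPowerSeries.C a) := by
    refine isConv_of_eq_one_add_mul (u := 1 - MvPowerSeries.C a⁻¹ * f) ?_ ?_ ?_
    · rw [sub_eq_add_neg]
      have h1 := isConv_C 1
      rw [map_one] at h1
      exact h1.add ((isConv_C a⁻¹).mul hf).neg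
    · change MvPowerSeries.constantCoeff (1 - MvPowerSeries.C a⁻¹ * f) = 0
      rw [map_sub, map_mul, MvPowerSeries.constantCoeff_C, map_one, ← ha, inv_mul_cancel₀ h0,
        sub_self]
    · rw [sub_mul, one_mul, mul_assoc, ← mul_assoc f, h1, one_mul, hC]
      abel
  have := hconv.mul (isConv_C a⁻¹)
  rwa [mul_assoc, hC', mul_one] at this

/-- The ring of convergent power series. -/
def convSubring : Subring PS where
  carrier := {c | IsConv c}
  mul_mem' := IsConv.mul
  one_mem' := by simpa using isConv_C 1
  add_mem' := IsConv.add
  zero_mem' := by simpa using isConv_C 0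
  neg_mem' := IsConv.neg

/-! ### Matrices over inverse-closed rings of power series -/

/-- A subring of power series that contains the inverses of its elements not vanishing at the
origin. -/
def InverseClosed (S : Subring PS) : Prop :=
  ∀ f ∈ S, MvPowerSeries.constantCoeff f ≠ 0 → ∃ g ∈ S, f * g = 1 ∧ g * f = 1

theorem inverseClosed_convSubring : InverseClosed convSubring := by
  intro f hf h0
  obtain ⟨g, hg, h⟩ := IsConv.exists_inv hf h0
  exact ⟨g, hg, h⟩

/-- The power series vanishing at the origin lie in the Jacobson radical of an inverse-closed
ring, and so do the matrices of such power series; hence `1 - Z` is invertible if `Z(0) = 0`. -/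
theorem InverseClosed.exists_matrix_inv {S : Subring PS} (hS : InverseClosed S) {p : ℕ}
    (Z : Matrix (Fin p) (Fin p) PS) (hZ : ∀ i j, Z i j ∈ S)
    (hZ0 : ∀ i j, MvPowerSeries.constantCoeff (Z i j) = 0) :
    ∃ x : Matrix (Fin p) (Fin p) PS,
      (∀ i j, x i j ∈ S) ∧ x * (1 - Z) = 1 ∧ (1 - Z) * x = 1 := by
  have hrad : ∀ y : S, MvPowerSeries.constantCoeff (y : PS) = 0 →
      y ∈ (⊥ : Ideal S).jacobson := by
    intro y hy
    rw [Ideal.mem_jacobson_iff]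
    intro r
    obtain ⟨g, hg, -, h⟩ := hS (r * y + 1) (S.add_mem (S.mul_mem r.2 y.2) S.one_mem)
      (by rw [map_add, map_mul, hy, mul_zero, zero_add, map_one]; exact one_ne_zero)
    refine ⟨⟨g, hg⟩, ?_⟩
    rw [Ideal.mem_bot, Subtype.ext_iff]
    push_cast
    rw [← h]
    noncomm_ring
  -- left inverses exist for the matrices congruent to `1` modulo the radical
  have hleft : ∀ U : Matrix (Fin p) (Fin p) S,
      (∀ i j, MvPowerSeries.constantCoeff (U i j : PS) = 0) → ∃ x, x * (1 - U) = 1 := by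
    intro U hU
    have h1 : U ∈ ((⊥ : Ideal S).matrix (Fin p)).jacobson :=
      Ideal.matrix_jacobson_le _ fun i j => hrad _ (hU i j)
    rw [Ideal.matrix_bot, Ideal.mem_jacobson_iff] at h1
    obtain ⟨z, hz⟩ := h1 (-1)
    rw [Ideal.mem_bot] at hz
    refine ⟨z, ?_⟩
    rw [← sub_eq_zero, ← hz]
    noncomm_ring
  set U : Matrix (Fin p) (Fin p) S := Matrix.of fun i j => ⟨Z i j, hZ i j⟩ with hU
  obtain ⟨x, hx⟩ := hleft U hZ0
  -- `x = 1 - (-x U)` is again congruent to `1`, so it has a left inverse, which must be `1 - U`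
  obtain ⟨y, hy⟩ := hleft (-(x * U)) (by
    intro i j
    simp [Matrix.mul_apply, hU, hZ0])
  have hx' : 1 - -(x * U) = x := by
    rw [mul_sub, mul_one, sub_eq_iff_eq_add] at hx
    rw [sub_neg_eq_add, ← hx]
  rw [hx'] at hy
  have hyx : y = 1 - U := by
    calc y = y * (x * (1 - U)) := by rw [hx, mul_one]
      _ = _ := by rw [← mul_assoc, hy, one_mul]
  rw [hyx] at hy
  have hmap : (S.subtype.mapMatrix (1 - U) : Matrix (Fin p) (Fin p) PS) = 1 - Z := by
    rw [map_sub, map_one]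
    rfl
  refine ⟨S.subtype.mapMatrix x, fun i j => (x i j).2, ?_, ?_⟩
  · rw [← hmap, ← map_mul, hx, map_one]
  · rw [← hmap, ← map_mul, hy, map_one]

/-! ### Uniqueness for analytic solutions of the Cauchy problem -/

section Cauchy

variable {E A : Type*} [NormedAddCommGroup E] [NormedSpace ℝ E] [NormedRing A] [NormedAlgebra ℝ A]
  [CompleteSpace A] {n : ℕ}

/-- The analytic solutions on `U` of the first order equation `∑ᵢ aᵢ ∂u/∂bᵢ = 0` that vanish on
the initial set `H`. -/
structure IsNullSolution (a : Fin (n + 1) → A) (b : Fin (n + 1) → E) (H U : Set E) (u : E → A) :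
    Prop where
  analytic : AnalyticOnNhd ℝ u U
  eq_zero : ∀ x ∈ U, ∑ i, a i * fderiv ℝ u x (b i) = 0
  initial : ∀ x ∈ U, x ∈ H → u x = 0

/-- If the directions `bₖ`, `k ≥ 1`, are tangent to the initial set, then the null solutions are
closed under directional derivatives: along `b₀` this is the equation itself. -/
theorem IsNullSolution.fderiv_apply {a : Fin (n + 1) → A} {b : Fin (n + 1) → E} {H U : Set E}
    {u : E → A} (ha : a 0 = 1) (hb : ∀ v, ∃ c : Fin (n + 1) → ℝ, v = ∑ i, c i • b i)
    (hH : ∀ x ∈ H, ∀ (t : ℝ) (k : Fin n), x + t • b k.succ ∈ H) (hU : IsOpen U)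
    (hu : IsNullSolution a b H U u) (v : E) :
    IsNullSolution a b H U fun x => fderiv ℝ u x v := by
  have hd : AnalyticOnNhd ℝ (fderiv ℝ u) U := hu.analytic.fderiv
  have hdd : ∀ x ∈ U, ∀ w, HasFDerivAt (fun x => fderiv ℝ u x w)
      ((ContinuousLinearMap.apply ℝ A w).comp (fderiv ℝ (fderiv ℝ u) x)) x := fun x hx w =>
    (ContinuousLinearMap.apply ℝ A w).hasFDerivAt.comp x (hd x hx).differentiableAt.hasFDerivAt
  refine ⟨?_, ?_, ?_⟩
  · exact (ContinuousLinearMap.apply ℝ A v).comp_analyticOnNhd hd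
  · intro x hx
    have hsymm : ∀ w, fderiv ℝ (fderiv ℝ u) x v w = fderiv ℝ (fderiv ℝ u) x w v := fun w =>
      ((hu.analytic x hx).contDiffAt (n := ⊤)).isSymmSndFDerivAt (by simp) v w
    have h1 : HasFDerivAt (fun y => ∑ i, a i * fderiv ℝ u y (b i))
        (∑ i, a i • ((ContinuousLinearMap.apply ℝ A (b i)).comp (fderiv ℝ (fderiv ℝ u) x))) x :=
      HasFDerivAt.fun_sum fun i _ => (hdd x hx (b i)).const_mul (a i)
    have h2 : (fun y => ∑ i, a i * fderiv ℝ u y (b i)) =ᶠ[𝓝 x] fun _ => 0 := by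
      filter_upwards [hU.mem_nhds hx] with y hy using hu.eq_zero y hy
    have h3 := h1.unique ((hasFDerivAt_const (0 : A) x).congr_of_eventuallyEq h2)
    have h4 := congrArg (fun L : E →L[ℝ] A => L v) h3
    simp only [sum_apply, smul_apply, ContinuousLinearMap.comp_apply,
      ContinuousLinearMap.apply_apply, zero_apply, smul_eq_mul] at h4
    rw [← h4]
    refine Finset.sum_congr rfl fun i _ => ?_
    rw [(hdd x hx v).fderiv, hsymm]
    rfl
  · intro x hx hxH
    have hk : ∀ k : Fin n, fderiv ℝ u x (b k.succ) = 0 := by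
      intro k
      have h1 : HasDerivAt (fun t : ℝ => x + t • b k.succ) (b k.succ) 0 := by
        simpa using ((hasDerivAt_id (0 : ℝ)).smul_const (b k.succ)).const_add x
      have h2 : HasFDerivAt u (fderiv ℝ u x) (x + (0 : ℝ) • b k.succ) := by
        simpa using (hu.analytic x hx).differentiableAt.hasFDerivAt
      have h3 := h2.comp_hasDerivAt (0 : ℝ) h1
      have h4 : (u ∘ fun t : ℝ => x + t • b k.succ) =ᶠ[𝓝 0] fun _ => 0 := by
        have : ∀ᶠ t : ℝ in 𝓝 0, x + t • b k.succ ∈ U :=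
          h1.continuousAt.eventually (hU.mem_nhds (by simpa using hx))
        filter_upwards [this] with t ht using hu.initial _ ht (hH x hxH t k)
      exact h3.unique ((hasDerivAt_const (0 : ℝ) (0 : A)).congr_of_eventuallyEq h4)
    have h0 : fderiv ℝ u x (b 0) = 0 := by
      have := hu.eq_zero x hx
      rw [Fin.sum_univ_succ, ha, one_mul] at this
      simpa [hk] using this
    obtain ⟨c, rfl⟩ := hb v
    rw [map_sum]
    refine Finset.sum_eq_zero fun i _ => ?_
    rw [map_smul]
    refine Fin.cases ?_ (fun k => ?_) i
    · rw [h0, smul_zero]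
    · rw [hk, smul_zero]

/-- Along each ray all derivatives of a null solution vanish at the origin. -/
theorem IsNullSolution.eqOn_zero {a : Fin (n + 1) → A} {b : Fin (n + 1) → E} {H U : Set E}
    {u : E → A} (ha : a 0 = 1) (hb : ∀ v, ∃ c : Fin (n + 1) → ℝ, v = ∑ i, c i • b i)
    (hH : ∀ x ∈ H, ∀ (t : ℝ) (k : Fin n), x + t • b k.succ ∈ H) (hU : IsOpen U)
    (hUc : Convex ℝ U) (h0 : (0 : E) ∈ U) (h0H : (0 : E) ∈ H) (hu : IsNullSolution a b H U u) :
    ∀ x ∈ U, u x = 0 := by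
  intro x hx
  set ℓ : ℝ →L[ℝ] E := ContinuousLinearMap.toSpanSingleton ℝ x with hℓ
  have hT : IsOpen (ℓ ⁻¹' U) := hU.preimage ℓ.continuous
  have hTc : Convex ℝ (ℓ ⁻¹' U) := hUc.linear_preimage ℓ.toLinearMap
  have hT0 : (0 : ℝ) ∈ ℓ ⁻¹' U := by simpa [hℓ] using h0
  have hT1 : (1 : ℝ) ∈ ℓ ⁻¹' U := by simpa [hℓ] using hx
  have han : AnalyticOnNhd ℝ (u ∘ ℓ) (ℓ ⁻¹' U) :=
    hu.analytic.comp (ℓ.analyticOnNhd _) fun t ht => ht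
  have hiter : ∀ (m : ℕ) (w : E → A), IsNullSolution a b H U w →
      iteratedDeriv m (w ∘ ℓ) 0 = 0 := by
    intro m
    induction m with
    | zero =>
      intro w hw
      rw [iteratedDeriv_zero, Function.comp, map_zero]
      exact hw.initial 0 h0 h0H
    | succ m ih =>
      intro w hw
      rw [iteratedDeriv_succ']
      have h1 : deriv (w ∘ ℓ) =ᶠ[𝓝 0] (fun y => fderiv ℝ w y x) ∘ ℓ := by
        filter_upwards [hT.mem_nhds hT0] with t ht
        have h2 : HasDerivAt ℓ x t := by
          have := ℓ.hasDerivAt (x := t)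
          simpa [hℓ] using this
        exact ((hw.analytic _ ht).differentiableAt.hasFDerivAt.comp_hasDerivAt t h2).deriv
      rw [h1.iteratedDeriv_eq]
      exact ih _ (hw.fderiv_apply ha hb hH hU x)
  have htop : analyticOrderAt (u ∘ ℓ) 0 = ⊤ := by
    refine ENat.eq_top_iff_forall_ge.mpr fun m => ?_
    rw [natCast_le_analyticOrderAt_iff_iteratedDeriv_eq_zero (han 0 hT0)]
    exact fun i _ => hiter i u hu
  have := han.eqOn_zero_of_preconnected_of_eventuallyEq_zero hTc.isPreconnected hT0
    (analyticOrderAt_eq_top.mp htop) hT1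
  simpa [hℓ] using this

end Cauchy

/-! ### Hyperholomorphic polynomials -/

theorem analyticAt_smul_sum_smul_mul {E A : Type*} [NormedAddCommGroup E] [NormedSpace ℝ E]
    [NormedRing A] [NormedAlgebra ℝ A] {ι : Type*} [Fintype ι] {F : E → A} {z g : ι → E → A}
    {a : ι → ℝ} {b : ℝ} {x : E} (hF : F = fun y => b • ∑ k, a k • (z k y * g k y))
    (h : ∀ k, a k ≠ 0 → AnalyticAt ℝ (z k) x ∧ AnalyticAt ℝ (g k) x) : AnalyticAt ℝ F x := by
  have h1 : AnalyticAt ℝ (fun y => ∑ k, a k • (z k y * g k y)) x := by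
    refine Finset.univ.analyticAt_fun_sum fun k _ => ?_
    rcases eq_or_ne (a k) 0 with h0 | h0
    · simpa only [h0, zero_smul] using analyticAt_const
    · exact ((h k h0).1.mul (h k h0).2).fun_const_smul
  rw [hF]
  exact h1.fun_const_smul

theorem analyticAt_zetaFun (k : Fin 3) (x : ℍ[ℝ]) : AnalyticAt ℝ (zetaFun k) x :=
  (zetaCLM k).analyticAt x

theorem analyticAt_fueter (ν : Fin 3 →₀ ℕ) (x : ℍ[ℝ]) : AnalyticAt ℝ (fueter ν) x := by
  obtain ⟨n, hn⟩ : ∃ n, ν.degree = n := ⟨_, rfl⟩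
  induction n generalizing ν with
  | zero =>
    rw [(Finsupp.degree_eq_zero_iff ν).mp hn]
    have h1 : fueter 0 = fun _ => 1 := funext fun x => fueter_zero x
    rw [h1]
    exact analyticAt_const
  | succ n ih =>
    have h1 : fueter ν = fun y => ((n + 1 : ℕ) : ℝ)⁻¹ •
        ∑ k, (ν k : ℝ) • (zetaFun k y * fueter (ν - Finsupp.single k 1) y) := by
      funext y
      rw [← degree_smul_fueter, hn, inv_smul_smul₀ (by positivity)]
    exact analyticAt_smul_sum_smul_mul h1 fun k h0 => ⟨analyticAt_zetaFun k x,
      ih _ (degree_sub_single (Nat.cast_ne_zero.mp h0) hn)⟩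

theorem eq_sum_coord_smul_e (x : ℍ[ℝ]) : x = ∑ i, coord x i • e i := by
  rw [Fin.sum_univ_four]
  ext <;> simp only [Quaternion.re_add, Quaternion.imI_add, Quaternion.imJ_add,
    Quaternion.imK_add, Quaternion.re_smul, Quaternion.imI_smul, Quaternion.imJ_smul,
    Quaternion.imK_smul] <;> simp [coord, e]

/-- The coordinate `xᵢ` as a continuous linear form. -/
def coordCLM (i : Fin 4) : ℍ[ℝ] →L[ℝ] ℝ := LinearMap.toContinuousLinearMap
  { toFun := fun x => coord x i
    map_add' := fun x y => by fin_cases i <;> simp [coord]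
    map_smul' := fun a x => by fin_cases i <;> simp [coord] }

theorem analyticAt_coord (i : Fin 4) (x : ℍ[ℝ]) : AnalyticAt ℝ (fun x => coord x i) x :=
  (coordCLM i).analyticAt x

/-- A subring containing the constants and the variables contains the monomials. -/
theorem monomial_mem {T : Subring PS} (hC : ∀ a, MvPowerSeries.C a ∈ T)
    (hX : ∀ k, MvPowerSeries.X k ∈ T) (ν : Fin 3 →₀ ℕ) (a : ℍ[ℝ]) :
    MvPowerSeries.monomial ν a ∈ T := by
  have hν : (Finsupp.single 0 (ν 0) + Finsupp.single 1 (ν 1) + Finsupp.single 2 (ν 2) + 0 :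
      Fin 3 →₀ ℕ) = ν := by
    ext k
    fin_cases k <;> simp
  have : MvPowerSeries.monomial ν a = MvPowerSeries.X 0 ^ ν 0 * MvPowerSeries.X 1 ^ ν 1 *
      MvPowerSeries.X 2 ^ ν 2 * MvPowerSeries.C a := by
    rw [← MvPowerSeries.monomial_zero_eq_C_apply]
    simp only [MvPowerSeries.X_pow_eq, MvPowerSeries.monomial_mul_monomial, one_mul, hν]
  rw [this]
  exact T.mul_mem (T.mul_mem (T.mul_mem (T.pow_mem (hX 0) _) (T.pow_mem (hX 1) _))
    (T.pow_mem (hX 2) _)) (hC a)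

/-- A hyperholomorphic polynomial is a finite combination of Fueter polynomials, obtained by
replacing each monomial `x₁^{ν₁} x₂^{ν₂} x₃^{ν₃}` of its restriction to `x₀ = 0` by `ζ^ν`: the
difference is a solution of the Cauchy-Fueter equation that vanishes for `x₀ = 0`. -/
theorem IsPolynomial.exists_hasFueterSeries {f : OH} (hf : IsPolynomial f) {T : Subring PS}
    (hC : ∀ a, MvPowerSeries.C a ∈ T) (hX : ∀ k, MvPowerSeries.X k ∈ T) :
    ∃ c ∈ T, HasFueterSeries f c := by
  obtain ⟨P, hP⟩ := hf
  set Pf : ℍ[ℝ] → ℍ[ℝ] := fun x => ∑ i, (P i).eval (coord x) • e i with hPf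
  set c : PS := ∑ i, ∑ m ∈ (P i).support, if m 0 = 0 then
    MvPowerSeries.monomial (Finsupp.tail m) ((P i).coeff m • e i) else 0 with hc
  have hcmem : ∀ T : Subring PS, (∀ a, MvPowerSeries.C a ∈ T) → (∀ k, MvPowerSeries.X k ∈ T) →
      c ∈ T := by
    intro T hC hX
    refine T.sum_mem fun i _ => T.sum_mem fun m _ => ?_
    split_ifs
    · exact monomial_mem hC hX _ _
    · exact T.zero_mem
  have hconv : IsConv c := hcmem convSubring isConv_C isConv_X
  set G : ℍ[ℝ] → ℍ[ℝ] := fun x => ∑ i, ∑ m ∈ (P i).support,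
    if m 0 = 0 then fueter (Finsupp.tail m) x * ((P i).coeff m • e i) else 0 with hG
  have hGsum : ∀ x, HasSum (fun ν => fueter ν x * c ν) (G x) := by
    intro x
    have h1 : ∀ ν, fueter ν x * c ν = ∑ i, ∑ m ∈ (P i).support, fueter ν x *
        (if m 0 = 0 then MvPowerSeries.monomial (Finsupp.tail m) ((P i).coeff m • e i)
          else (0 : PS)) ν := by
      intro ν
      have h2 : c ν = ∑ i, ∑ m ∈ (P i).support, (if m 0 = 0 then
          MvPowerSeries.monomial (Finsupp.tail m) ((P i).coeff m • e i) else (0 : PS)) ν := by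
        have h3 := congrArg (MvPowerSeries.coeff ν) hc
        simp only [map_sum] at h3
        exact h3
      rw [h2, Finset.mul_sum]
      simp only [Finset.mul_sum]
    simp only [h1]
    refine hasSum_sum fun i _ => hasSum_sum fun m _ => ?_
    split_ifs with hm
    · convert hasSum_single (Finsupp.tail m) ?_ using 2
      · exact (MvPowerSeries.coeff_monomial_same _ _).symm
      · intro μ hμ
        exact mul_eq_zero_of_right _ (MvPowerSeries.coeff_monomial_ne hμ _)
    · have : ∀ ν, (0 : PS) ν = 0 := fun ν => rfl
      simpa only [this, mul_zero] using hasSum_zero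
  refine ⟨c, hcmem T hC hX, G, ?_, Filter.Eventually.of_forall hGsum⟩
  have hGh : HyperholoNearZero G := by
    have : G = fueterSum c := funext fun x => (hGsum x).tsum_eq.symm
    rw [this]
    exact hyperholoNearZero_fueterSum hconv
  have hPh : HyperholoNearZero Pf := by
    obtain ⟨F, hF, hFh⟩ := f.2
    have h1 : F =ᶠ[𝓝 0] Pf := Filter.Germ.coe_eq.mp (hF.symm.trans hP)
    filter_upwards [hFh, h1.eventuallyEq_nhds] with x hx hx'
    refine ⟨hx.1.congr_of_eventuallyEq hx'.symm, ?_⟩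
    simpa only [partialDeriv, hx'.fderiv_eq] using hx.2
  have hGa : ∀ x, AnalyticAt ℝ G x := by
    intro x
    refine Finset.univ.analyticAt_fun_sum fun i _ => Finset.analyticAt_fun_sum _ fun m _ => ?_
    split_ifs
    · exact (analyticAt_fueter _ x).mul analyticAt_const
    · exact analyticAt_const
  have hPa : ∀ x, AnalyticAt ℝ Pf x := by
    intro x
    refine Finset.univ.analyticAt_fun_sum fun i _ => ?_
    have h1 : AnalyticAt ℝ (fun x => (P i).eval (coord x)) x :=
      AnalyticAt.aeval_mvPolynomial (fun j => analyticAt_coord j x) (P i)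
    exact h1.fun_smul analyticAt_const
  obtain ⟨r, hr, hball⟩ := Metric.eventually_nhds_iff_ball.mp (hPh.and hGh)
  have hnull : IsNullSolution e e {x : ℍ[ℝ] | coord x 0 = 0} (Metric.ball 0 r)
      (fun x => Pf x - G x) := by
    refine ⟨fun x _ => (hPa x).fun_sub (hGa x), fun x hx => ?_, fun x _ hx => ?_⟩
    · obtain ⟨⟨h1, h2⟩, h3, h4⟩ := hball x hx
      have h5 : ∀ i, fderiv ℝ (fun x => Pf x - G x) x (e i) =
          partialDeriv i Pf x - partialDeriv i G x := by
        intro i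
        rw [fderiv_fun_sub h1 h3]
        rfl
      simp only [h5, mul_sub, Finset.sum_sub_distrib, h2, h4, sub_zero]
    · rw [sub_eq_zero]
      refine Finset.sum_congr rfl fun i _ => ?_
      rw [MvPolynomial.eval_eq', Finset.sum_smul]
      refine Finset.sum_congr rfl fun m _ => ?_
      have hz : ∀ k, zetaFun k x = ((coord x k.succ : ℝ) : ℍ[ℝ]) := by
        intro k
        rw [zetaFun, show coord x 0 = 0 from hx, zero_smul, sub_zero]
      rw [Fin.prod_univ_succ, show coord x 0 = 0 from hx]
      split_ifs with hm
      · rw [fueter_coe _ _ hz, hm, pow_zero, one_mul, Quaternion.coe_mul_eq_smul, smul_smul,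
          mul_comm]
        rfl
      · rw [zero_pow hm, zero_mul, mul_zero, zero_smul]
  have hzero := hnull.eqOn_zero (by ext <;> simp [e]) (fun v => ⟨coord v, eq_sum_coord_smul_e v⟩)
    (by
      intro x hx t k
      have h1 : coord (x + t • e k.succ) 0 = coord x 0 + t • coord (e k.succ) 0 :=
        ((coordCLM 0).map_add _ _).trans (congrArg _ ((coordCLM 0).map_smul t (e k.succ)))
      have h2 : coord (e k.succ) 0 = 0 := by fin_cases k <;> simp [coord, e]
      change coord (x + t • e k.succ) 0 = 0
      rw [h1, h2, show coord x 0 = 0 from hx, smul_zero, add_zero])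
    Metric.isOpen_ball (convex_ball 0 r) (Metric.mem_ball_self hr) (by simp [coord])
  rw [hP]
  refine Filter.Germ.coe_eq.mpr ?_
  filter_upwards [Metric.ball_mem_nhds (0 : ℍ[ℝ]) hr] with x hx
  exact sub_eq_zero.mp (hzero x hx)

theorem isPolynomial_of_eq {f : OH} {F : ℍ[ℝ] → ℍ[ℝ]} (hf : (f : QGerm) = (F : QGerm))
    (P : Fin 4 → MvPolynomial (Fin 4) ℝ) (hF : ∀ x i, coord (F x) i = (P i).eval (coord x)) :
    IsPolynomial f := by
  refine ⟨P, hf.trans (congrArg _ (funext fun x => ?_))⟩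
  rw [eq_sum_coord_smul_e (F x)]
  simp only [hF]

theorem isPolynomial_const (a : ℍ[ℝ]) : IsPolynomial (const a) :=
  isPolynomial_of_eq (F := fun _ => a) rfl (fun i => MvPolynomial.C (coord a i)) fun x i => by simp

theorem isPolynomial_zeta (k : Fin 3) : IsPolynomial (zeta k) := by
  refine isPolynomial_of_eq (F := zetaFun k) rfl
    (fun i => if i = 0 then MvPolynomial.X k.succ
      else if i = k.succ then - MvPolynomial.X 0 else 0) fun x i => ?_
  have h : coord (zetaFun k x) i =
      coord ((coord x k.succ : ℝ) : ℍ[ℝ]) i - coord x 0 * coord (e k.succ) i := by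
    have h1 := (coordCLM i).map_sub ((coord x k.succ : ℝ) : ℍ[ℝ]) (coord x 0 • e k.succ)
    rw [(coordCLM i).map_smul] at h1
    exact h1
  rw [h]
  fin_cases k <;> fin_cases i <;> simp [coord, e]

/-! ### Realizations as matrix identities between power series -/

open MvPowerSeries (C X constantCoeff)

theorem hasFueterSeries_zero : HasFueterSeries 0 0 := by
  simpa using (hasFueterSeries_const 0).op_smul 0

theorem HasFueterSeries.sum {ι : Type*} {s : Finset ι} {f : ι → OH} {c : ι → PS}
    (h : ∀ i ∈ s, HasFueterSeries (f i) (c i)) :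
    HasFueterSeries (∑ i ∈ s, f i) (∑ i ∈ s, c i) := by
  classical
  induction s using Finset.induction_on with
  | empty => exact hasFueterSeries_zero
  | insert i s hi ih =>
    rw [Finset.sum_insert hi, Finset.sum_insert hi]
    exact (h i (Finset.mem_insert_self i s)).add
      (ih fun j hj => h j (Finset.mem_insert_of_mem hj))

theorem HasFueterSeries.neg {f : OH} {c : PS} (h : HasFueterSeries f c) :
    HasFueterSeries (-f) (-c) := by
  obtain ⟨F, hF, hF'⟩ := h
  refine ⟨-F, ?_, ?_⟩
  · rw [Submodule.coe_neg, hF]; rfl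
  · filter_upwards [hF'] with x h1
    exact h1.neg.congr_fun fun ν => mul_neg _ _

theorem HasFueterSeries.sub {f g : OH} {c d : PS} (hf : HasFueterSeries f c)
    (hg : HasFueterSeries g d) : HasFueterSeries (f - g) (c - d) := by
  rw [sub_eq_add_neg, sub_eq_add_neg]
  exact hf.add hg.neg

theorem HasFueterSeries.val_eq {f : OH} {c : PS} (h : HasFueterSeries f c) :
    val f = constantCoeff c := by
  rw [Hyperholo.val_eq, h.ser_eq]

theorem ser_zeta (k : Fin 3) : ser (zeta k) = X k := (hasFueterSeries_zeta k).ser_eq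

/-- The entries of `F` are the sums of the Fueter series with coefficients the entries of `c`. -/
def HasMatSeries {a b : ℕ} (F : Matrix (Fin a) (Fin b) OH) (c : Matrix (Fin a) (Fin b) PS) :
    Prop :=
  ∀ i j, HasFueterSeries (F i j) (c i j)

theorem HasMatSeries.map_ser {a b : ℕ} {F : Matrix (Fin a) (Fin b) OH}
    {c : Matrix (Fin a) (Fin b) PS} (h : HasMatSeries F c) : F.map ser = c :=
  Matrix.ext fun i j => (h i j).ser_eq

theorem IsMatCKProd.hasMatSeries {a b c : ℕ} {F : Matrix (Fin a) (Fin b) OH}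
    {G : Matrix (Fin b) (Fin c) OH} {H : Matrix (Fin a) (Fin c) OH} (h : IsMatCKProd F G H) :
    HasMatSeries H (F.map ser * G.map ser) := by
  obtain ⟨T, hT, hH⟩ := h
  intro i k
  rw [hH, Matrix.mul_apply]
  exact HasFueterSeries.sum fun j _ => isCKProd_iff.mp (hT i j k)

theorem isMatCKProd_of_hasMatSeries {a b c : ℕ} {F : Matrix (Fin a) (Fin b) OH}
    {G : Matrix (Fin b) (Fin c) OH} {H : Matrix (Fin a) (Fin c) OH}
    {φ : Matrix (Fin a) (Fin b) PS} {ψ : Matrix (Fin b) (Fin c) PS} (hF : HasMatSeries F φ)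
    (hG : HasMatSeries G ψ) (hH : HasMatSeries H (φ * ψ)) : IsMatCKProd F G H := by
  have hconv : ∀ i j k, IsConv (φ i j * ψ j k) := fun i j k =>
    (hF i j).isConv.mul (hG j k).isConv
  refine ⟨fun i j k => ofPS _ (hconv i j k), fun i j k => ?_, fun i k => ?_⟩
  · rw [isCKProd_iff, (hF i j).ser_eq, (hG j k).ser_eq]
    exact hasFueterSeries_ofPS _
  · refine (hH i k).unique ?_
    rw [Matrix.mul_apply]
    exact HasFueterSeries.sum fun j _ => hasFueterSeries_ofPS _

/-- A constant matrix, as a matrix of power series. -/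
def constPS {a b : ℕ} (M : Matrix (Fin a) (Fin b) ℍ[ℝ]) : Matrix (Fin a) (Fin b) PS :=
  fun i j => C (M i j)

theorem constPS_one (p : ℕ) : constPS (1 : Matrix (Fin p) (Fin p) ℍ[ℝ]) = 1 :=
  Matrix.map_one _ (map_zero C) (map_one C)

theorem hasMatSeries_constMat {a b : ℕ} (M : Matrix (Fin a) (Fin b) ℍ[ℝ]) :
    HasMatSeries (constMat M) (constPS M) :=
  fun i j => hasFueterSeries_const (M i j)

/-- The linear matrix pencil `X₁ M₁ + X₂ M₂ + X₃ M₃`. -/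
def pencil {a b : ℕ} (M : Fin 3 → Matrix (Fin a) (Fin b) ℍ[ℝ]) : Matrix (Fin a) (Fin b) PS :=
  fun i j => ∑ k, X k * C (M k i j)

theorem hasMatSeries_zetaMat {a b : ℕ} (M : Fin 3 → Matrix (Fin a) (Fin b) ℍ[ℝ]) :
    HasMatSeries (zetaMat M) (pencil M) :=
  fun i j => HasFueterSeries.sum fun k _ => (hasFueterSeries_zeta k).op_smul (M k i j)

theorem constantCoeff_pencil {a b : ℕ} (M : Fin 3 → Matrix (Fin a) (Fin b) ℍ[ℝ]) (i : Fin a)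
    (j : Fin b) : constantCoeff (pencil M i j) = 0 := by
  simp [pencil]

theorem pencil_mem {a b : ℕ} {T : Subring PS} (hC : ∀ a, C a ∈ T) (hX : ∀ k, X k ∈ T)
    (M : Fin 3 → Matrix (Fin a) (Fin b) ℍ[ℝ]) (i : Fin a) (j : Fin b) : pencil M i j ∈ T :=
  T.sum_mem fun k _ => T.mul_mem (hX k) (hC _)

theorem hasMatSeries_one_sub {p : ℕ} (A : Fin 3 → Matrix (Fin p) (Fin p) ℍ[ℝ]) :
    HasMatSeries (constMat 1 - zetaMat A) (1 - pencil A) := by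
  rw [← constPS_one]
  exact fun i j => (hasMatSeries_constMat 1 i j).sub (hasMatSeries_zetaMat A i j)

theorem InverseClosed.exists_pencil_inv {S : Subring PS} (hS : InverseClosed S)
    (hC : ∀ a, C a ∈ S) (hX : ∀ k, X k ∈ S) {p : ℕ} (A : Fin 3 → Matrix (Fin p) (Fin p) ℍ[ℝ]) :
    ∃ x : Matrix (Fin p) (Fin p) PS,
      (∀ i j, x i j ∈ S) ∧ x * (1 - pencil A) = 1 ∧ (1 - pencil A) * x = 1 :=
  hS.exists_matrix_inv (pencil A) (pencil_mem hC hX A) (constantCoeff_pencil A)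

/-- A realization, as an identity between matrices of power series. -/
theorem hasRealization_iff {m n : ℕ} {R : Matrix (Fin m) (Fin n) OH} :
    HasRealization R ↔ ∃ (p : ℕ) (A : Fin 3 → Matrix (Fin p) (Fin p) ℍ[ℝ])
      (B : Fin 3 → Matrix (Fin p) (Fin n) ℍ[ℝ]) (Γ : Matrix (Fin m) (Fin p) ℍ[ℝ])
      (D : Matrix (Fin m) (Fin n) ℍ[ℝ]) (x : Matrix (Fin p) (Fin p) PS),
      x * (1 - pencil A) = 1 ∧ (1 - pencil A) * x = 1 ∧
        HasMatSeries R (constPS D + constPS Γ * x * pencil B) := by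
  constructor
  · rintro ⟨p, A, B, Γ, D, x, y, z, ⟨hx, hx'⟩, hy, hz, rfl⟩
    refine ⟨p, A, B, Γ, D, x.map ser, ?_, ?_, ?_⟩
    · rw [← (hasMatSeries_one_sub A).map_ser, ← hx'.hasMatSeries.map_ser,
        (hasMatSeries_constMat 1).map_ser, constPS_one]
    · rw [← (hasMatSeries_one_sub A).map_ser, ← hx.hasMatSeries.map_ser,
        (hasMatSeries_constMat 1).map_ser, constPS_one]
    · have hz' := hz.hasMatSeries
      rw [hy.hasMatSeries.map_ser, (hasMatSeries_zetaMat B).map_ser,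
        (hasMatSeries_constMat Γ).map_ser] at hz'
      exact fun i j => (hasMatSeries_constMat D i j).add (hz' i j)
  · rintro ⟨p, A, B, Γ, D, x, hx, hx', hR⟩
    obtain ⟨x₁, hx₁, h₁, -⟩ := inverseClosed_convSubring.exists_pencil_inv isConv_C isConv_X A
    have hxx : x = x₁ := (left_inv_eq_right_inv h₁ hx').symm
    have hxc : ∀ i j, IsConv (x i j) := by rw [hxx]; exact hx₁
    have hyc : ∀ i j, IsConv ((constPS Γ * x) i j) := fun i j => by
      rw [Matrix.mul_apply]
      exact convSubring.sum_mem fun k _ => (isConv_C _).mul (hxc k j)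
    have hzc : ∀ i j, IsConv ((constPS Γ * x * pencil B) i j) := fun i j => by
      rw [Matrix.mul_apply]
      exact convSubring.sum_mem fun k _ =>
        convSubring.mul_mem (hyc i k) (pencil_mem isConv_C isConv_X B k j)
    have hX : HasMatSeries (fun i j => ofPS _ (hxc i j)) x := fun i j => hasFueterSeries_ofPS _
    have hY : HasMatSeries (fun i j => ofPS _ (hyc i j)) (constPS Γ * x) :=
      fun i j => hasFueterSeries_ofPS _
    have hZ : HasMatSeries (fun i j => ofPS _ (hzc i j)) (constPS Γ * x * pencil B) :=
      fun i j => hasFueterSeries_ofPS _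
    have hI := hasMatSeries_constMat (1 : Matrix (Fin p) (Fin p) ℍ[ℝ])
    rw [constPS_one] at hI
    refine ⟨p, A, B, Γ, D, fun i j => ofPS _ (hxc i j), fun i j => ofPS _ (hyc i j),
      fun i j => ofPS _ (hzc i j), ⟨?_, ?_⟩, ?_, ?_, ?_⟩
    · exact isMatCKProd_of_hasMatSeries (hasMatSeries_one_sub A) hX (by rw [hx']; exact hI)
    · exact isMatCKProd_of_hasMatSeries hX (hasMatSeries_one_sub A) (by rw [hx]; exact hI)
    · exact isMatCKProd_of_hasMatSeries (hasMatSeries_constMat Γ) hX hY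
    · exact isMatCKProd_of_hasMatSeries hY (hasMatSeries_zetaMat B) hZ
    · exact Matrix.ext fun i j =>
        (hR i j).unique ((hasMatSeries_constMat D i j).add (hZ i j))

/-! ### Realizations and resolvent-invariant spaces -/

theorem gleasonSolvableIn_of_series {m : ℕ} {W : Submodule ℍ[ℝ]ᵐᵒᵖ (Fin m → OH)}
    {f : Fin m → OH} {d : Fin m → ℍ[ℝ]} {g : Fin 3 → Fin m → OH} {c : Fin 3 → Fin m → PS}
    (hgW : ∀ k, g k ∈ W) (hg : ∀ k i, HasFueterSeries (g k i) (c k i))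
    (hf : ∀ i, HasFueterSeries (f i) (C (d i) + ∑ k, X k * c k i)) : GleasonSolvableIn W f := by
  have hconv : ∀ k i, IsConv (X k * c k i) := fun k i => (isConv_X k).mul (hg k i).isConv
  refine ⟨g, fun k i => ofPS _ (hconv k i), hgW, fun k i => ?_, funext fun i => ?_⟩
  · rw [isCKProd_iff, ser_zeta, (hg k i).ser_eq]
    exact hasFueterSeries_ofPS _
  · have hval : val (f i) = d i := by
      rw [(hf i).val_eq]
      simp
    rw [Pi.sub_apply, hval, Finset.sum_apply]
    refine HasFueterSeries.unique (c := ∑ k, X k * c k i) ?_ ?_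
    · simpa using (hf i).sub (hasFueterSeries_const (d i))
    · exact HasFueterSeries.sum fun k _ => hasFueterSeries_ofPS _

theorem GleasonSolvableIn.exists_series {m : ℕ} {W : Submodule ℍ[ℝ]ᵐᵒᵖ (Fin m → OH)}
    {f : Fin m → OH} (h : GleasonSolvableIn W f) : ∃ g : Fin 3 → Fin m → OH, (∀ k, g k ∈ W) ∧
      ∀ i, HasFueterSeries (f i) (C (val (f i)) + ∑ k, X k * ser (g k i)) := by
  obtain ⟨g, h, hgW, hh, hf⟩ := h
  refine ⟨g, hgW, fun i => ?_⟩
  have h1 := congrFun hf i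
  rw [Pi.sub_apply, Finset.sum_apply, sub_eq_iff_eq_add, add_comm] at h1
  have h2 : HasFueterSeries (const (val (f i)) + ∑ k, h k i)
      (C (val (f i)) + ∑ k, X k * ser (g k i)) := by
    refine (hasFueterSeries_const _).add (HasFueterSeries.sum fun k _ => ?_)
    have h3 := isCKProd_iff.mp (hh k i)
    rwa [ser_zeta] at h3
  rwa [← h1] at h2

theorem pencil_mulVec {a b : ℕ} (M : Fin 3 → Matrix (Fin a) (Fin b) ℍ[ℝ]) (v : Fin b → ℍ[ℝ]) :
    (pencil M).mulVec (fun j => C (v j)) = fun i => ∑ k, X k * C ((M k).mulVec v i) := by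
  funext i
  simp only [Matrix.mulVec, dotProduct, pencil, Finset.sum_mul, map_sum, map_mul, Finset.mul_sum]
  rw [Finset.sum_comm]
  simp only [mul_assoc]

theorem HasRealization.hasResolventInvariantSpace {m n : ℕ} {R : Matrix (Fin m) (Fin n) OH}
    (hR : HasRealization R) : HasResolventInvariantSpace R := by
  obtain ⟨p, A, B, Γ, D, x, hx, hx', hR⟩ := hasRealization_iff.mp hR
  obtain ⟨x₁, hx₁, h₁, -⟩ := inverseClosed_convSubring.exists_pencil_inv isConv_C isConv_X A
  have hxx : x = x₁ := (left_inv_eq_right_inv h₁ hx').symm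
  have hxc : ∀ i j, IsConv (x i j) := by rw [hxx]; exact hx₁
  set y := constPS Γ * x with hy
  have hyc : ∀ i j, IsConv (y i j) := fun i j => by
    rw [hy, Matrix.mul_apply]
    exact convSubring.sum_mem fun k _ => (isConv_C _).mul (hxc k j)
  have hyA : y = constPS Γ + y * pencil A := by
    have : y * (1 - pencil A) = constPS Γ := by rw [hy, Matrix.mul_assoc, hx, Matrix.mul_one]
    rw [← this, Matrix.mul_sub, Matrix.mul_one, sub_add_cancel]
  -- the space spanned by the columns of `Y = C ⊙ (I - ζA)^{-⊙}`
  set Y : Fin p → Fin m → OH := fun j i => ofPS _ (hyc i j) with hY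
  set W : Submodule ℍ[ℝ]ᵐᵒᵖ (Fin m → OH) := Submodule.span _ (Set.range Y) with hW
  have hcomb : ∀ (v : Fin p → ℍ[ℝ]) (i : Fin m),
      HasFueterSeries ((∑ j, MulOpposite.op (v j) • Y j) i) (y.mulVec (fun j => C (v j)) i) := by
    intro v i
    rw [Finset.sum_apply]
    exact HasFueterSeries.sum fun j _ => (hasFueterSeries_ofPS (hyc i j)).op_smul (v j)
  have hsolve : ∀ (f : Fin m → OH) (d : Fin m → ℍ[ℝ]) (q : Fin 3 → Fin p → ℍ[ℝ]),
      (∀ i, HasFueterSeries (f i)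
        (C (d i) + y.mulVec (fun l => ∑ k, X k * C (q k l)) i)) → GleasonSolvableIn W f := by
    intro f d q hf
    refine gleasonSolvableIn_of_series (d := d) (g := fun k => ∑ j, MulOpposite.op (q k j) • Y j)
      (fun k => Submodule.sum_mem _ fun j _ => Submodule.smul_mem _ _
        (Submodule.subset_span ⟨j, rfl⟩)) (fun k i => hcomb (q k) i) fun i => ?_
    convert hf i using 2
    simp only [Matrix.mulVec, dotProduct, Finset.mul_sum]
    rw [Finset.sum_comm]
    simp only [← mul_assoc, (MvPowerSeries.commute_X _ _).eq]
  have hconst : ∀ {a b : ℕ} (M : Matrix (Fin a) (Fin b) ℍ[ℝ]) (v : Fin b → ℍ[ℝ]) (i : Fin a),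
      (constPS M).mulVec (fun j => (C (v j) : PS)) i = C (M.mulVec v i) := by
    intro a b M v i
    simp [Matrix.mulVec, dotProduct, map_sum, constPS]
  refine ⟨W, ?_, ?_, ?_⟩
  · exact FiniteDimensional.span_of_finite _ (Set.finite_range Y)
  · intro f hf
    obtain ⟨v, rfl⟩ := (Submodule.mem_span_range_iff_exists_fun _).mp hf
    refine hsolve _ (Γ.mulVec fun j => (v j).unop) (fun k => (A k).mulVec fun j => (v j).unop)
      fun i => ?_
    have h2 := hcomb (fun j => (v j).unop) i
    rw [hyA, Matrix.add_mulVec, ← Matrix.mulVec_mulVec, pencil_mulVec, Pi.add_apply, hconst] at h2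
    exact h2
  · intro v
    refine hsolve _ (D.mulVec v) (fun k => (B k).mulVec v) fun i => ?_
    have h2 : HasFueterSeries (applyVec R v i)
        ((constPS D + y * pencil B).mulVec (fun j => C (v j)) i) :=
      HasFueterSeries.sum fun j _ => (hR i j).op_smul (v j)
    rwa [Matrix.add_mulVec, ← Matrix.mulVec_mulVec, pencil_mulVec, Pi.add_apply, hconst] at h2

/-- Generators of a resolvent-invariant space, as the columns of a matrix `Φ`, satisfy
`Φ = C + Φ ζA`, so that `Φ = C ⊙ (I - ζA)^{-⊙}`. -/
theorem HasResolventInvariantSpace.hasRealization {m n : ℕ} {R : Matrix (Fin m) (Fin n) OH}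
    (hR : HasResolventInvariantSpace R) : HasRealization R := by
  obtain ⟨W, hfin, hres, hRv⟩ := hR
  obtain ⟨p, b, hb⟩ := Submodule.fg_iff_exists_fin_generating_family.mp (Module.Finite.iff_fg.mp hfin)
  have hbW : ∀ j, b j ∈ W := fun j => hb ▸ Submodule.subset_span ⟨j, rfl⟩
  have hser : ∀ f ∈ W, ∀ i, HasFueterSeries (f i) (ser (f i)) := by
    intro f hf i
    obtain ⟨g, -, hg⟩ := (hres f hf).exists_series
    rw [(hg i).ser_eq]
    exact hg i
  set Φ : Matrix (Fin m) (Fin p) PS := fun i j => ser (b j i) with hΦ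
  have hcomb : ∀ g ∈ W, ∃ q : Fin p → ℍ[ℝ],
      ∀ i, ser (g i) = ∑ l, Φ i l * C (q l) := by
    intro g hg
    rw [← hb] at hg
    obtain ⟨q, rfl⟩ := (Submodule.mem_span_range_iff_exists_fun _).mp hg
    refine ⟨fun l => (q l).unop, fun i => ?_⟩
    have h2 : HasFueterSeries ((∑ l, q l • b l) i) (∑ l, Φ i l * C (q l).unop) := by
      rw [Finset.sum_apply]
      exact HasFueterSeries.sum fun l _ => (hser _ (hbW l) i).op_smul (q l).unop
    exact h2.ser_eq
  have hgl : ∀ f, GleasonSolvableIn W f → ∃ q : Fin 3 → Fin p → ℍ[ℝ], ∀ i,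
      HasFueterSeries (f i) (C (val (f i)) + ∑ l, Φ i l * ∑ k, X k * C (q k l)) := by
    intro f hf
    obtain ⟨g, hgW, hg⟩ := hf.exists_series
    choose q hq using fun k => hcomb (g k) (hgW k)
    refine ⟨q, fun i => ?_⟩
    convert hg i using 2
    simp only [hq, Finset.mul_sum]
    rw [Finset.sum_comm]
    simp only [← mul_assoc, (MvPowerSeries.commute_X _ _).eq]
  choose A hA using fun j => hgl _ (hres _ (hbW j))
  choose B hB using fun j : Fin n => hgl _ (hRv (Pi.single j 1))
  have happ : ∀ j i, applyVec R (Pi.single j 1) i = R i j := by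
    intro j i
    rw [applyVec, Finset.sum_eq_single j]
    · simp
    · intro l _ hl
      simp [hl]
    · simp
  set Γ : Matrix (Fin m) (Fin p) ℍ[ℝ] := fun i j => val (b j i) with hΓ
  set A' : Fin 3 → Matrix (Fin p) (Fin p) ℍ[ℝ] := fun k l j => A j k l with hA'
  have hΦA : Φ = constPS Γ + Φ * pencil A' := Matrix.ext fun i j => (hA j i).ser_eq
  obtain ⟨x, -, hx, hx'⟩ := inverseClosed_convSubring.exists_pencil_inv isConv_C isConv_X A'
  have hΦx : Φ = constPS Γ * x := by
    have : Φ * (1 - pencil A') = constPS Γ := by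
      rw [Matrix.mul_sub, Matrix.mul_one]
      nth_rewrite 1 [hΦA]
      rw [add_sub_cancel_right]
    rw [← this, Matrix.mul_assoc, hx', Matrix.mul_one]
  refine hasRealization_iff.mpr ⟨p, A', fun k l j => B j k l, Γ, fun i j => val (R i j), x, hx,
    hx', fun i j => ?_⟩
  rw [← hΦx]
  have := hB j i
  rw [happ] at this
  exact this

/-! ### Realizations are rational -/

/-- The power series of the elements of an inversion-closed subring of germs. -/
def IsInversionClosedSubring.toSubring {S : AddSubgroup OH} (hS : IsInversionClosedSubring S) :
    Subring PS where
  carrier := {c | ∃ f ∈ S, HasFueterSeries f c}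
  mul_mem' := by
    rintro c d ⟨f, hf, hc⟩ ⟨g, hg, hd⟩
    have hcd := hc.isConv.mul hd.isConv
    refine ⟨ofPS _ hcd, hS.mul_mem f g _ hf hg ?_, hasFueterSeries_ofPS hcd⟩
    rw [isCKProd_iff, hc.ser_eq, hd.ser_eq]
    exact hasFueterSeries_ofPS hcd
  one_mem' := ⟨const 1, hS.one_mem, by simpa using hasFueterSeries_const 1⟩
  add_mem' := by
    rintro c d ⟨f, hf, hc⟩ ⟨g, hg, hd⟩
    exact ⟨f + g, S.add_mem hf hg, hc.add hd⟩
  zero_mem' := ⟨0, S.zero_mem, hasFueterSeries_zero⟩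
  neg_mem' := by
    rintro c ⟨f, hf, hc⟩
    exact ⟨-f, S.neg_mem hf, hc.neg⟩

theorem IsCKInv.mul_ser {f g : OH} (h : IsCKInv f g) :
    ser f * ser g = 1 ∧ ser g * ser f = 1 := by
  have h1 : ser (const 1) = 1 := by simpa using (hasFueterSeries_const 1).ser_eq
  rw [← h1]
  exact ⟨(isCKProd_iff.mp h.1).ser_eq.symm, (isCKProd_iff.mp h.2).ser_eq.symm⟩

/-- The inverse provided by the inversion-closed subring need not be known to be the sum of its
Fueter series; multiplying it by `1` replaces it by the sum of that series. -/
theorem IsInversionClosedSubring.inverseClosed {S : AddSubgroup OH}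
    (hS : IsInversionClosedSubring S) : InverseClosed hS.toSubring := by
  rintro c ⟨f, hf, hc⟩ h0
  obtain ⟨g, hg, hfg⟩ := hS.inv_mem f hf (by rwa [hc.val_eq])
  obtain ⟨d, hd, hcd, hdc⟩ := hc.isConv.exists_inv h0
  have hgd : ser g = d := by
    have := hfg.mul_ser.2
    rw [hc.ser_eq] at this
    exact left_inv_eq_right_inv this hcd
  refine ⟨d, ⟨ofPS d hd, hS.mul_mem (const 1) g _ hS.one_mem hg ?_, hasFueterSeries_ofPS hd⟩,
    hcd, hdc⟩
  rw [isCKProd_iff, (hasFueterSeries_const 1).ser_eq, map_one, one_mul, hgd]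
  exact hasFueterSeries_ofPS hd

theorem HasRealization.isCKRational {m n : ℕ} {R : Matrix (Fin m) (Fin n) OH}
    (hR : HasRealization R) : IsCKRational R := by
  intro i j S hS
  obtain ⟨p, A, B, Γ, D, x, hx, hx', hR⟩ := hasRealization_iff.mp hR
  have hC : ∀ a, C a ∈ hS.toSubring := fun a =>
    ⟨const a, hS.poly_mem _ (isPolynomial_const a), hasFueterSeries_const a⟩
  have hX : ∀ k, X k ∈ hS.toSubring := fun k =>
    ⟨zeta k, hS.poly_mem _ (isPolynomial_zeta k), hasFueterSeries_zeta k⟩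
  obtain ⟨x₁, hx₁, h₁, -⟩ := hS.inverseClosed.exists_pencil_inv hC hX A
  have hxx : x = x₁ := (left_inv_eq_right_inv h₁ hx').symm
  have hmem : (constPS D + constPS Γ * x * pencil B) i j ∈ hS.toSubring := by
    rw [Matrix.add_apply, Matrix.mul_apply, hxx]
    refine Subring.add_mem _ (hC _) (Subring.sum_mem _ fun l _ => Subring.mul_mem _ ?_
      (pencil_mem hC hX B l j))
    rw [Matrix.mul_apply]
    exact Subring.sum_mem _ fun k _ => Subring.mul_mem _ (hC _) (hx₁ k l)
  obtain ⟨f, hf, hfc⟩ := hmem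
  rw [(hR i j).unique hfc]
  exact hf

/-! ### Backward-shift invariant spaces of power series -/

theorem smul_eq_C_mul (r : ℝ) (c : PS) : r • c = C (r : ℍ[ℝ]) * c := by
  ext1 ν
  rw [MvPowerSeries.coeff_C_mul, Quaternion.coe_mul_eq_smul]
  rfl

theorem smul_eq_mul_C (r : ℝ) (c : PS) : r • c = c * C (r : ℍ[ℝ]) := by
  ext1 ν
  rw [MvPowerSeries.coeff_mul_C, Quaternion.mul_coe_eq_smul]
  rfl

/-- An instance of `mul_assoc` that `rw` does not find: the real module structure of `PS` agrees with
that of its algebra structure only after unfolding. -/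
theorem space_mul_assoc (U V W : Submodule ℝ PS) : U * V * W = U * (V * W) :=
  mul_assoc U V W

/-- The constant power series, as a real vector space. -/
def constSpace : Submodule ℝ PS where
  carrier := Set.range C
  add_mem' := by rintro _ _ ⟨a, rfl⟩ ⟨b, rfl⟩; exact ⟨a + b, map_add _ _ _⟩
  zero_mem' := ⟨0, map_zero _⟩
  smul_mem' := by
    rintro r _ ⟨a, rfl⟩
    exact ⟨r * a, by rw [smul_eq_C_mul, map_mul]⟩

theorem one_mem_constSpace : (1 : PS) ∈ constSpace := ⟨1, map_one C⟩

theorem constSpace_fg : constSpace.FG := by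
  have h : constSpace = LinearMap.range
      ({ toFun := C, map_add' := map_add C, map_smul' := fun r a => by
          rw [RingHom.id_apply, smul_eq_C_mul, ← map_mul, Quaternion.coe_mul_eq_smul] } :
        ℍ[ℝ] →ₗ[ℝ] PS) := rfl
  rw [h]
  exact Module.Finite.iff_fg.mp inferInstance

theorem constSpace_mul_self : constSpace * constSpace ≤ constSpace := by
  rw [Submodule.mul_le]
  rintro _ ⟨a, rfl⟩ _ ⟨b, rfl⟩
  exact ⟨a * b, map_mul _ _ _⟩

/-- The convergent power series, as a real vector space. -/
def convSpace : Submodule ℝ PS where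
  carrier := {c | IsConv c}
  add_mem' := IsConv.add
  zero_mem' := convSubring.zero_mem
  smul_mem' r c hc := by
    change IsConv (r • c)
    rw [smul_eq_C_mul]
    exact (isConv_C _).mul hc

theorem convSpace_mul_self : convSpace * convSpace ≤ convSpace :=
  Submodule.mul_le.mpr fun _ hc _ hd => IsConv.mul hc hd

/-- The power series `c` for which `c - c(0) = X₁ g₁ + X₂ g₂ + X₃ g₃` has a solution in `V`. -/
def gleasonSpace (V : Submodule ℝ PS) : Submodule ℝ PS where
  carrier := {c | ∃ (a : ℍ[ℝ]) (g : Fin 3 → PS), (∀ k, g k ∈ V) ∧ c = C a + ∑ k, X k * g k}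
  add_mem' := by
    rintro _ _ ⟨a, g, hg, rfl⟩ ⟨b, h, hh, rfl⟩
    refine ⟨a + b, g + h, fun k => V.add_mem (hg k) (hh k), ?_⟩
    simp only [map_add, Pi.add_apply, mul_add, Finset.sum_add_distrib]
    abel
  zero_mem' := ⟨0, 0, fun _ => V.zero_mem, by simp⟩
  smul_mem' := by
    rintro r _ ⟨a, g, hg, rfl⟩
    refine ⟨r * a, r • g, fun k => V.smul_mem r (hg k), ?_⟩
    simp only [smul_add, Finset.smul_sum, Pi.smul_apply, mul_smul_comm, map_mul]
    rw [smul_eq_C_mul]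

theorem gleasonSpace_mono {V W : Submodule ℝ PS} (h : V ≤ W) : gleasonSpace V ≤ gleasonSpace W := by
  rintro _ ⟨a, g, hg, rfl⟩
  exact ⟨a, g, fun k => h (hg k), rfl⟩

theorem C_mem_gleasonSpace (V : Submodule ℝ PS) (a : ℍ[ℝ]) : C a ∈ gleasonSpace V :=
  ⟨a, 0, fun _ => V.zero_mem, by simp⟩

theorem sum_X_mul_mem_gleasonSpace {V : Submodule ℝ PS} {g : Fin 3 → PS} (hg : ∀ k, g k ∈ V) :
    ∑ k, X k * g k ∈ gleasonSpace V :=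
  ⟨0, g, hg, by simp⟩

theorem X_mul_mem_gleasonSpace {V : Submodule ℝ PS} {c : PS} (k : Fin 3) (hc : c ∈ V) :
    X k * c ∈ gleasonSpace V := by
  have h : X k * c = ∑ j, X j * (Pi.single k c : Fin 3 → PS) j := by
    rw [Finset.sum_eq_single k]
    · simp
    · intro j _ hj
      simp [hj]
    · simp
  rw [h]
  refine sum_X_mul_mem_gleasonSpace fun j => ?_
  rcases eq_or_ne j k with rfl | hj
  · simpa using hc
  · simp [hj]

/-- The finite-dimensional spaces of convergent power series that are stable under left
multiplication by constants and in which every element has a solution of the Gleason problem. -/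
structure IsBackwardSpace (V : Submodule ℝ PS) : Prop where
  fg : V.FG
  conv : V ≤ convSpace
  const_mul : constSpace * V ≤ V
  gleason : V ≤ gleasonSpace V

theorem isBackwardSpace_constSpace : IsBackwardSpace constSpace where
  fg := constSpace_fg
  conv := by rintro _ ⟨a, rfl⟩; exact isConv_C a
  const_mul := constSpace_mul_self
  gleason := by rintro _ ⟨a, rfl⟩; exact C_mem_gleasonSpace _ a

theorem IsBackwardSpace.sup {V W : Submodule ℝ PS} (hV : IsBackwardSpace V)
    (hW : IsBackwardSpace W) : IsBackwardSpace (V ⊔ W) where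
  fg := hV.fg.sup hW.fg
  conv := sup_le hV.conv hW.conv
  const_mul := by
    rw [Submodule.mul_sup]
    exact sup_le_sup hV.const_mul hW.const_mul
  gleason := sup_le (hV.gleason.trans (gleasonSpace_mono le_sup_left))
    (hW.gleason.trans (gleasonSpace_mono le_sup_right))

theorem isBackwardSpace_X (k : Fin 3) :
    IsBackwardSpace (constSpace ⊔ (ℝ ∙ (X k : PS)) * constSpace) := by
  have hcomm : constSpace * (ℝ ∙ (X k : PS)) ≤ (ℝ ∙ (X k : PS)) * constSpace := by
    rw [Submodule.mul_le]
    rintro _ ⟨a, rfl⟩ y hy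
    obtain ⟨r, rfl⟩ := Submodule.mem_span_singleton.mp hy
    rw [mul_smul_comm, (MvPowerSeries.commute_X _ _).eq]
    exact Submodule.smul_mem _ _
      (Submodule.mul_mem_mul (Submodule.mem_span_singleton_self _) ⟨a, rfl⟩)
  refine ⟨constSpace_fg.sup ((Submodule.fg_span_singleton _).mul constSpace_fg),
    sup_le isBackwardSpace_constSpace.conv ?_, ?_,
    sup_le (fun _ ⟨a, h⟩ => h ▸ C_mem_gleasonSpace _ a) ?_⟩
  · refine (Submodule.mul_le.mpr ?_)
    intro x hx _ ⟨a, ha⟩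
    rw [← ha]
    refine convSpace_mul_self (Submodule.mul_mem_mul ?_ (isConv_C a))
    exact (Submodule.span_singleton_le_iff_mem _ _).mpr (isConv_X k) hx
  · rw [Submodule.mul_sup, ← space_mul_assoc]
    refine sup_le_sup constSpace_mul_self ((mul_le_mul_left hcomm _).trans ?_)
    rw [space_mul_assoc]
    exact mul_le_mul_right constSpace_mul_self _
  · intro c hc
    obtain ⟨d, hd, rfl⟩ := Submodule.mem_span_singleton_mul.mp hc
    exact X_mul_mem_gleasonSpace k (Submodule.mem_sup_left hd)

/-- The product rule `f g = f(0) g(0) + ∑ₖ Xₖ (f(0) gₖ + fₖ g)`. -/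
theorem IsBackwardSpace.mul {V W : Submodule ℝ PS} (hV : IsBackwardSpace V)
    (hW : IsBackwardSpace W) : IsBackwardSpace (V * W ⊔ W) where
  fg := (hV.fg.mul hW.fg).sup hW.fg
  conv := sup_le ((mul_le_mul' hV.conv hW.conv).trans convSpace_mul_self) hW.conv
  const_mul := by
    rw [Submodule.mul_sup, ← space_mul_assoc]
    exact sup_le_sup (mul_le_mul_left hV.const_mul _) hW.const_mul
  gleason := by
    refine sup_le (Submodule.mul_le.mpr fun f hf g hg => ?_)
      (hW.gleason.trans (gleasonSpace_mono le_sup_right))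
    obtain ⟨a, f', hf', rfl⟩ := hV.gleason hf
    rw [add_mul, Finset.sum_mul]
    refine Submodule.add_mem _ (gleasonSpace_mono le_sup_right (hW.gleason
      (hW.const_mul (Submodule.mul_mem_mul ⟨a, rfl⟩ hg)))) ?_
    simp only [mul_assoc]
    exact sum_X_mul_mem_gleasonSpace fun k =>
      Submodule.mem_sup_left (Submodule.mul_mem_mul (hf' k) hg)

/-- If `c = c(0) + ∑ₖ Xₖ gₖ` and `d` is the inverse of `c`, then
`f d = f(0) c(0)⁻¹ + ∑ₖ Xₖ (fₖ - f(0) c(0)⁻¹ gₖ) d`. -/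
theorem IsBackwardSpace.mul_inv {V : Submodule ℝ PS} (hV : IsBackwardSpace V) {c d : PS}
    (hc : c ∈ V) (h0 : constantCoeff c ≠ 0) (hd : IsConv d) (hcd : c * d = 1) :
    IsBackwardSpace (V * (ℝ ∙ d)) where
  fg := hV.fg.mul (Submodule.fg_span_singleton _)
  conv := (mul_le_mul' hV.conv ((Submodule.span_singleton_le_iff_mem _ _).mpr hd)).trans
    convSpace_mul_self
  const_mul := by
    rw [← space_mul_assoc]
    exact mul_le_mul_left hV.const_mul _
  gleason := by
    intro y hy
    obtain ⟨f, hf, rfl⟩ := Submodule.mem_mul_span_singleton.mp hy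
    obtain ⟨a, f', hf', rfl⟩ := hV.gleason hf
    obtain ⟨b, g, hg, rfl⟩ := hV.gleason hc
    have hb : b ≠ 0 := by simpa using h0
    have h1 : C (a * b⁻¹) * (C b * d) = C a * d := by
      rw [← mul_assoc, ← map_mul, mul_assoc, inv_mul_cancel₀ hb, mul_one]
    refine ⟨a * b⁻¹, fun k => (f' k - C (a * b⁻¹) * g k) * d, fun k =>
      Submodule.mul_mem_mul (V.sub_mem (hf' k) (hV.const_mul (Submodule.mul_mem_mul ⟨_, rfl⟩
        (hg k)))) (Submodule.mem_span_singleton_self d), ?_⟩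
    have h2 : C b * d = 1 - ∑ k, X k * (g k * d) := by
      rw [← hcd, add_mul, Finset.sum_mul]
      simp only [mul_assoc, add_sub_cancel_right]
    rw [add_mul, ← h1, h2, mul_sub, mul_one, Finset.mul_sum, Finset.sum_mul]
    simp only [sub_mul, mul_sub, Finset.sum_sub_distrib, ← mul_assoc,
      (MvPowerSeries.commute_X _ _).eq]
    abel

/-- The power series that lie in some backward space. -/
def backwardSubring : Subring PS where
  carrier := {c | ∃ V, IsBackwardSpace V ∧ c ∈ V}
  mul_mem' := by
    rintro c d ⟨V, hV, hc⟩ ⟨W, hW, hd⟩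
    exact ⟨_, hV.mul hW, Submodule.mem_sup_left (Submodule.mul_mem_mul hc hd)⟩
  one_mem' := ⟨_, isBackwardSpace_constSpace, 1, map_one _⟩
  add_mem' := by
    rintro c d ⟨V, hV, hc⟩ ⟨W, hW, hd⟩
    exact ⟨_, hV.sup hW, Submodule.add_mem_sup hc hd⟩
  zero_mem' := ⟨_, isBackwardSpace_constSpace, Submodule.zero_mem _⟩
  neg_mem' := by
    rintro c ⟨V, hV, hc⟩
    exact ⟨V, hV, V.neg_mem hc⟩

theorem C_mem_backwardSubring (a : ℍ[ℝ]) : C a ∈ backwardSubring :=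
  ⟨_, isBackwardSpace_constSpace, a, rfl⟩

theorem X_mem_backwardSubring (k : Fin 3) : X k ∈ backwardSubring :=
  ⟨_, isBackwardSpace_X k, Submodule.mem_sup_right <| Submodule.mem_span_singleton_mul.mpr
    ⟨1, one_mem_constSpace, mul_one _⟩⟩

theorem inverseClosed_backwardSubring : InverseClosed backwardSubring := by
  rintro c ⟨V, hV, hc⟩ h0
  obtain ⟨d, hd, hcd, hdc⟩ := IsConv.exists_inv (hV.conv hc) h0
  -- adjoining the constants to `V` makes `d = 1 d` an element of the new space
  have hV' := hV.sup isBackwardSpace_constSpace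
  refine ⟨d, ⟨_, hV'.mul_inv (Submodule.mem_sup_left hc) h0 hd hcd, ?_⟩, hcd, hdc⟩
  exact Submodule.mem_mul_span_singleton.mpr
    ⟨1, Submodule.mem_sup_right one_mem_constSpace, one_mul d⟩

/-! ### Rational functions have realizations -/

/-- The germs whose power series lie in a given ring of power series. -/
def germSubgroup (T : Subring PS) : AddSubgroup OH where
  carrier := {f | ∃ c ∈ T, HasFueterSeries f c}
  add_mem' := by
    rintro f g ⟨c, hc, hf⟩ ⟨d, hd, hg⟩
    exact ⟨c + d, T.add_mem hc hd, hf.add hg⟩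
  zero_mem' := ⟨0, T.zero_mem, hasFueterSeries_zero⟩
  neg_mem' := by
    rintro f ⟨c, hc, hf⟩
    exact ⟨-c, T.neg_mem hc, hf.neg⟩

theorem InverseClosed.isInversionClosedSubring {T : Subring PS} (hT : InverseClosed T)
    (hC : ∀ a, C a ∈ T) (hX : ∀ k, X k ∈ T) : IsInversionClosedSubring (germSubgroup T) where
  one_mem := ⟨C 1, hC 1, hasFueterSeries_const 1⟩
  mul_mem := by
    rintro f g h ⟨c, hc, hf⟩ ⟨d, hd, hg⟩ hfg
    rw [isCKProd_iff, hf.ser_eq, hg.ser_eq] at hfg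
    exact ⟨c * d, T.mul_mem hc hd, hfg⟩
  poly_mem f hf := hf.exists_hasFueterSeries hC hX
  inv_mem := by
    rintro f ⟨c, hc, hf⟩ h0
    rw [hf.val_eq] at h0
    obtain ⟨d, hdT, hcd, hdc⟩ := hT c hc h0
    obtain ⟨d', hd', h1, -⟩ := hf.isConv.exists_inv h0
    obtain rfl : d = d' := left_inv_eq_right_inv hdc h1
    have h1 := hasFueterSeries_const 1
    rw [map_one] at h1
    refine ⟨ofPS d hd', ⟨d, hdT, hasFueterSeries_ofPS hd'⟩, ?_, ?_⟩
    · rw [isCKProd_iff, hf.ser_eq, (hasFueterSeries_ofPS hd').ser_eq, hcd]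
      exact h1
    · rw [isCKProd_iff, hf.ser_eq, (hasFueterSeries_ofPS hd').ser_eq, hdc]
      exact h1

theorem exists_isBackwardSpace_forall_mem {ι : Type*} [Finite ι] {c : ι → PS}
    (h : ∀ i, c i ∈ backwardSubring) : ∃ V, IsBackwardSpace V ∧ ∀ i, c i ∈ V := by
  classical
  cases nonempty_fintype ι
  choose V hV hc using h
  have : ∀ s : Finset ι, ∃ W, IsBackwardSpace W ∧ ∀ i ∈ s, c i ∈ W := by
    intro s
    induction s using Finset.induction_on with
    | empty => exact ⟨_, isBackwardSpace_constSpace, by simp⟩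
    | insert i s _ ih =>
      obtain ⟨W, hW, h⟩ := ih
      refine ⟨_, (hV i).sup hW, fun j hj => ?_⟩
      rcases Finset.mem_insert.mp hj with rfl | hj
      · exact Submodule.mem_sup_left (hc _)
      · exact Submodule.mem_sup_right (h j hj)
  obtain ⟨W, hW, h⟩ := this Finset.univ
  exact ⟨W, hW, fun i => h i (Finset.mem_univ i)⟩

/-- The columns whose entries have their power series in a space `V` stable under right
multiplication by constants. -/
def columnSpace (m : ℕ) {V : Submodule ℝ PS} (hV : V * constSpace ≤ V) :
    Submodule ℍ[ℝ]ᵐᵒᵖ (Fin m → OH) where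
  carrier := {f | ∀ i, ∃ c ∈ V, HasFueterSeries (f i) c}
  add_mem' := by
    intro f g hf hg i
    obtain ⟨c, hc, hfc⟩ := hf i
    obtain ⟨d, hd, hgd⟩ := hg i
    exact ⟨c + d, V.add_mem hc hd, hfc.add hgd⟩
  zero_mem' _ := ⟨0, V.zero_mem, hasFueterSeries_zero⟩
  smul_mem' := by
    intro a f hf i
    obtain ⟨c, hc, hfc⟩ := hf i
    exact ⟨c * C a.unop, hV (Submodule.mul_mem_mul hc ⟨_, rfl⟩), hfc.op_smul a.unop⟩

theorem finiteDimensional_columnSpace (m : ℕ) {V : Submodule ℝ PS} (hV : V * constSpace ≤ V)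
    (hfg : V.FG) (hconv : V ≤ convSpace) :
    FiniteDimensional ℍ[ℝ]ᵐᵒᵖ (columnSpace m hV) := by
  obtain ⟨s, rfl⟩ := hfg
  have hs : ∀ c : s, IsConv (c : PS) := fun c => hconv (Submodule.subset_span c.2)
  set L : Submodule ℍ[ℝ]ᵐᵒᵖ (Fin m → OH) := Submodule.span _
    (Set.range fun p : Fin m × s => Pi.single p.1 (ofPS p.2 (hs p.2))) with hL
  have : FiniteDimensional ℍ[ℝ]ᵐᵒᵖ L := FiniteDimensional.span_of_finite _ (Set.finite_range _)
  have key : ∀ i, ∀ c ∈ Submodule.span ℝ (s : Set PS),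
      ∃ f, HasFueterSeries f c ∧ (Pi.single i f : Fin m → OH) ∈ L := by
    intro i c hc
    induction hc using Submodule.span_induction with
    | mem c hc =>
      exact ⟨_, hasFueterSeries_ofPS (hs ⟨c, hc⟩), Submodule.subset_span ⟨(i, ⟨c, hc⟩), rfl⟩⟩
    | zero => exact ⟨0, hasFueterSeries_zero, by simp⟩
    | add c d _ _ hc hd =>
      obtain ⟨f, hf, hfL⟩ := hc
      obtain ⟨g, hg, hgL⟩ := hd
      exact ⟨f + g, hf.add hg, by rw [Pi.single_add]; exact L.add_mem hfL hgL⟩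
    | smul r c _ hc =>
      obtain ⟨f, hf, hfL⟩ := hc
      refine ⟨MulOpposite.op (r : ℍ[ℝ]) • f, ?_, ?_⟩
      · rw [smul_eq_mul_C]
        exact hf.op_smul _
      · rw [Pi.single_smul]
        exact L.smul_mem _ hfL
  refine Submodule.finiteDimensional_of_le (S₂ := L) fun f hf => ?_
  rw [← Finset.univ_sum_single f]
  refine L.sum_mem fun i _ => ?_
  obtain ⟨c, hc, hfc⟩ := hf i
  obtain ⟨g, hg, hgL⟩ := key i c hc
  rwa [hfc.unique hg]

theorem gleasonSolvableIn_columnSpace {m : ℕ} {V : Submodule ℝ PS} (hV : V * constSpace ≤ V)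
    (hconv : V ≤ convSpace) (hgl : V ≤ gleasonSpace V) {f : Fin m → OH}
    (hf : f ∈ columnSpace m hV) : GleasonSolvableIn (columnSpace m hV) f := by
  choose c hc hfc using hf
  choose d g hg hcg using fun i => hgl (hc i)
  refine gleasonSolvableIn_of_series (d := d) (g := fun k i => ofPS (g i k) (hconv (hg i k)))
    (c := fun k i => g i k) (fun k i => ⟨_, hg i k, hasFueterSeries_ofPS _⟩)
    (fun k i => hasFueterSeries_ofPS _) fun i => ?_
  rw [← hcg i]
  exact hfc i

theorem IsCKRational.hasResolventInvariantSpace {m n : ℕ} {R : Matrix (Fin m) (Fin n) OH}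
    (hR : IsCKRational R) : HasResolventInvariantSpace R := by
  have hmem : ∀ p : Fin m × Fin n, ∃ c ∈ backwardSubring, HasFueterSeries (R p.1 p.2) c :=
    fun p => hR p.1 p.2 _ (inverseClosed_backwardSubring.isInversionClosedSubring
      C_mem_backwardSubring X_mem_backwardSubring)
  choose c hc hRc using hmem
  obtain ⟨V, hV, hcV⟩ := exists_isBackwardSpace_forall_mem hc
  -- the right `ℍ`-module generated by `V`
  have hright : V * constSpace * constSpace ≤ V * constSpace := by
    rw [space_mul_assoc]
    exact mul_le_mul_right constSpace_mul_self _
  have hconv : V * constSpace ≤ convSpace :=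
    (mul_le_mul' hV.conv isBackwardSpace_constSpace.conv).trans convSpace_mul_self
  have hgl : V * constSpace ≤ gleasonSpace (V * constSpace) := by
    refine Submodule.mul_le.mpr ?_
    rintro f hf _ ⟨b, rfl⟩
    obtain ⟨a, g, hg, rfl⟩ := hV.gleason hf
    refine ⟨a * b, fun k => g k * C b, fun k => Submodule.mul_mem_mul (hg k) ⟨b, rfl⟩, ?_⟩
    simp only [add_mul, Finset.sum_mul, map_mul, mul_assoc]
  refine ⟨columnSpace m hright,
    finiteDimensional_columnSpace m hright (hV.fg.mul constSpace_fg) hconv,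
    fun f hf => gleasonSolvableIn_columnSpace hright hconv hgl hf,
    fun v => gleasonSolvableIn_columnSpace hright hconv hgl fun i =>
      ⟨∑ j, c (i, j) * C (v j), Submodule.sum_mem _ fun j _ =>
        Submodule.mul_mem_mul (hcV (i, j)) ⟨v j, rfl⟩,
        HasFueterSeries.sum fun j _ => (hRc (i, j)).op_smul (v j)⟩⟩

end

end Hyperholo

theorem mainTheorem2 (m n : ℕ) (R : Matrix (Fin m) (Fin n) Hyperholo.OH) :
    (Hyperholo.HasRealization R ↔ Hyperholo.HasResolventInvariantSpace R) ∧
      (Hyperholo.IsCKRational R ↔ Hyperholo.HasRealization R) :=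
  ⟨⟨Hyperholo.HasRealization.hasResolventInvariantSpace,
    Hyperholo.HasResolventInvariantSpace.hasRealization⟩,
    fun h => h.hasResolventInvariantSpace.hasRealization, Hyperholo.HasRealization.isCKRational⟩
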